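/- **Conventions.** Let $(K,v)$ be a non-trivially valued algebraically closed field with value group $\Gamma_K$ (written additively, $v(0)=+\infty$), valuation ring $\mathcal O_K$ with maximal ideal $\mathcal M_K$, and let $p$ be the characteristic exponent of $K$ ($p=1$ if $\mathrm{char}\,K=0$, and $p=\mathrm{char}\,K$ otherwise). Let $\mathrm{RV}^*=K^\times/(1+\mathcal M_K)$, $\mathrm{RV}=\mathrm{RV}^*\cup\{0\}$, and let $\mathrm{rv}\colon K\to\mathrm{RV}$ be the quotient map with $\mathrm{rv}(0)=0$. Raising to the power $p$ is bijective on $K$ and on $\mathrm{RV}$, so $x^{n/p^m}$ is well defined on both for $n,m\in\mathbb Z$ and $x\ne0$. Let $\mathcal L$ be a language extending the language $(+,-,\cdot,0,1,\mathrm{div})$ of valued fields, where $\mathrm{div}(x,y)$ means $v(x)\le v(y)$, and let $(K,\mathcal L)$ be an expansion of $(K,v)$ that is *$C$-minimal*: in every $\mathcal L$-structure elementarily equivalent to it, every definable subset of the field is a boolean combination of (open or closed) balls. Definable means definable with parameters; for sets and functions involving $\Gamma_K$ or $\mathrm{RV}^*$ it means interpretable (the preimage in a power of $K$ is definable). A *neighborhood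 of infinity* is a set $\{x\in K: v(x)<\gamma\}$ with $\gamma\in\Gamma_K$; $\lim_{x\to\infty}F(x)=a\in K$ means that for every $\gamma\in\Gamma_K$ there is $\delta\in\Gamma_K$ with $v(F(x)-a)>\gamma$ whenever $v(x)<\delta$. **Theorem ($\mathrm{RV}$-factorization I).** Let $W\subseteq K^k$ be definable and let $f\colon X\subseteq W\times K\to K^\times$ be a definable family of functions such that, for every $w\in W$, the domain $X_w$ of $f_w$ contains a neighborhood of infinity. Let $h\colon Y\subseteq W\times\Gamma_K\to\Gamma_K$ be a definable family which is a $\Gamma$-factorization of $f$ at infinity: for every $w\in W$ there is $\gamma_0\in\Gamma_K$ such that for all $x\in X_w$ with $v(x)<\gamma_0$ one has $v(x)\in Y_w$ and $v(f_w(x))=h_w(v(x))$. Suppose that $h$ is eventually $\mathbb Q$-linear at infinity: there is a finite set $Z\subseteq\mathbb Q$ such that for every $w\in W$ there are $r\in Z$ and $\delta,\alpha\in\Gamma_K$ with $\gamma\in Y_w$ and $h_w(\gamma)=r\gamma+\alpha$ for all $\gamma<\delta$. Then there are a finite partition of $W$ into definable sets $W_1,\dots,W_\ell$, integers $n_1,\dots,n_\ell,m_1,\dots,m_\ell$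 and a definable function $c\colon W\to\mathrm{RV}^*$ such that, for all $i$ and all $w\in W_i$, for all $x$ in a neighborhood of infinity, $$\mathrm{rv}(f_w(x))=\mathrm{rv}(x)^{n_i/p^{m_i}}\,c(w).$$ If in addition * $(K,\mathcal L)$ is definably complete, i.e. every definable family of nested balls whose set of radii tends to $+\infty$ has non-empty intersection, and * every definable function $g\colon\Gamma_K\to\Gamma_K$ is eventually linear, i.e. there are $\delta,\alpha\in\Gamma_K$ and an endomorphism $\lambda$ of the group $(\Gamma_K,+)$ with $g(\gamma)=\lambda(\gamma)+\alpha$ for all $\gamma>\delta$, then for all $i$ and all $w\in W_i$ the limit $$a(w):=\lim_{x\to\infty}\frac{f_w(x)}{x^{n_i/p^{m_i}}}$$ exists in $K$, and $c(w)=\mathrm{rv}(a(w))$. -/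

import Mathlib

open FirstOrder Set

universe uK uF uR uG

/-! ### The language of valued fields -/

/-- Function symbols of the language of valued fields: `+`, `-`, `·`, `0`, `1`. -/
inductive DivFunc : ℕ → Type
  | zero : DivFunc 0
  | one : DivFunc 0
  | add : DivFunc 2
  | sub : DivFunc 2
  | mul : DivFunc 2

/-- The only relation symbol of the language of valued fields: the binary predicate `div`. -/
inductive DivRel : ℕ → Type
  | div : DivRel 2

/-- The language `(+, -, ·, 0, 1, div)` of valued fields. -/
def Ldiv : FirstOrder.Language.{0, 0} := ⟨DivFunc, DivRel⟩

section ValuedField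

variable {K : Type uK} [Field K] {Γ : Type uG} [AddCommGroup Γ] [LinearOrder Γ]
  [IsOrderedAddMonoid Γ]

/-- A valued field as a structure in the language of valued fields; `div(x, y)` holds iff
`v x ≤ v y`. -/
@[reducible] def divStructure (v : AddValuation K (WithTop Γ)) : Ldiv.Structure K where
  funMap := fun {_} s =>
    match s with
    | DivFunc.zero => fun _ => 0
    | DivFunc.one => fun _ => 1
    | DivFunc.add => fun x => x 0 + x 1
    | DivFunc.sub => fun x => x 0 - x 1
    | DivFunc.mul => fun x => x 0 * x 1
  RelMap := fun {_} r =>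
    match r with
    | DivRel.div => fun x => v (x 0) ≤ v (x 1)

/-- The `L`-structure on `K` expands the valued field `(K, v)`, where `L` contains the language of
valued fields through `φ`. -/
def IsValuedFieldExpansion (v : AddValuation K (WithTop Γ)) {L : FirstOrder.Language.{uF, uR}}
    [L.Structure K] (φ : FirstOrder.Language.LHom Ldiv L) : Prop :=
  letI := divStructure v
  φ.IsExpansionOn K

end ValuedField

/-! ### `C`-minimality -/

section CMinimal

variable {L : FirstOrder.Language.{uF, uR}} (φ : FirstOrder.Language.LHom Ldiv L) (M : Type*) [L.Structure M]

/-- `v x ≤ v y`, as expressed by the language of valued fields inside an `L`-structure. -/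
def divRel (x y : M) : Prop := Language.Structure.RelMap (φ.onRelation DivRel.div) ![x, y]

/-- Subtraction, as expressed by the language of valued fields inside an `L`-structure. -/
def divSub (x y : M) : M := Language.Structure.funMap (φ.onFunction DivFunc.sub) ![x, y]

/-- Zero, as expressed by the language of valued fields inside an `L`-structure. -/
def divZero : M := Language.Structure.funMap (φ.onFunction DivFunc.zero) ![]

/-- The balls of a model: closed balls `{x | v (x - a) ≥ v b}` (with `b = 0` for radius `+∞`),
open balls `{x | v (x - a) > v b}` with `b ≠ 0`, and the whole field (radius `-∞`). -/
def modelBalls : Set (Set M) :=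
  {B | (∃ a b : M, B = {x | divRel φ M b (divSub φ M x a)}) ∨
    (∃ a b : M, b ≠ divZero φ M ∧ B = {x | ¬ divRel φ M (divSub φ M x a) b}) ∨
    B = univ}

/-- `K` is `C`-minimal: in every elementarily equivalent structure, every unary set definable with
parameters is a boolean combination of balls.  By the downward Löwenheim–Skolem theorem the universe
in which the elementarily equivalent structures live is large enough to be immaterial. -/
def IsCMinimal (K : Type uK) [L.Structure K] : Prop :=
  ∀ (N : Type (max uK uF uR)) [L.Structure N], (K ≅[L] N) →
    ∀ S : Set N, (univ : Set N).Definable₁ L S → S ∈ BooleanSubalgebra.closure (modelBalls φ N)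

end CMinimal

/-! ### Balls, `RV` and fractional powers -/

section RV

variable {K : Type uK} [Field K] {Γ : Type uG} [AddCommGroup Γ] [LinearOrder Γ]
  [IsOrderedAddMonoid Γ] (v : AddValuation K (WithTop Γ))

/-- `B` is a ball of the given radius in `Γ ∪ {-∞, +∞}`. -/
inductive IsBall : Set K → WithBot (WithTop Γ) → Prop
  | closed (a : K) (γ : WithTop Γ) : IsBall {x | γ ≤ v (x - a)} (γ : WithBot (WithTop Γ))
  | opened (a : K) (γ : Γ) :
      IsBall {x | (γ : WithTop Γ) < v (x - a)} ((γ : WithTop Γ) : WithBot (WithTop Γ))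
  | whole : IsBall univ ⊥

/-- The subgroup `1 + 𝓜` of `Kˣ`. -/
def oneUnits : Subgroup Kˣ where
  carrier := {u | 0 < v ((u : K) - 1)}
  one_mem' := by simp
  mul_mem' := by
    intro a b ha hb
    simp only [Set.mem_ofPred_eq] at ha hb ⊢
    have h1 : 0 ≤ v (a : K) := by
      have := v.map_add ((a : K) - 1) 1
      rw [sub_add_cancel, v.map_one, min_eq_right ha.le] at this
      exact this
    have : ((a * b : Kˣ) : K) - 1 = a * ((b : K) - 1) + ((a : K) - 1) := by push_cast; ring
    rw [this]
    refine v.map_lt_add ?_ ha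
    rw [v.map_mul]
    exact lt_of_lt_of_le hb (le_add_of_nonneg_left h1)
  inv_mem' := by
    intro a ha
    simp only [Set.mem_ofPred_eq] at ha ⊢
    have h0 : v (a : K) = 0 := by
      have := v.map_eq_of_lt_sub (x := 1) (y := (a : K)) (by rw [v.map_one]; exact ha)
      rw [this, v.map_one]
    have h : ((a⁻¹ : Kˣ) : K) - 1 = -((a⁻¹ : Kˣ) : K) * ((a : K) - 1) := by
      have := a.inv_mul
      linear_combination this
    have hinv : v ((a⁻¹ : Kˣ) : K) = 0 := by
      have := congrArg v a.inv_mul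
      rwa [v.map_mul, v.map_one, h0, add_zero] at this
    rw [h, v.map_mul, v.map_neg, hinv, zero_add]
    exact ha

/-- `RV* = Kˣ / (1 + 𝓜)`. -/
def RVStar : Type uK := Kˣ ⧸ oneUnits v

instance : CommGroup (RVStar v) := inferInstanceAs (CommGroup (Kˣ ⧸ oneUnits v))

/-- The quotient map `Kˣ → RV*`. -/
def RVStar.mk : Kˣ →* RVStar v := QuotientGroup.mk' (oneUnits v)

theorem RVStar.mk_surjective : Function.Surjective (RVStar.mk v) :=
  QuotientGroup.mk'_surjective (oneUnits v)

theorem RVStar.mk_eq_one_iff (u : Kˣ) : RVStar.mk v u = 1 ↔ 0 < v ((u : K) - 1) :=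
  QuotientGroup.eq_one_iff u

/-- `RV = RV* ∪ {0}`. -/
abbrev RV : Type uK := WithZero (RVStar v)

open Classical in
/-- The map `rv : K → RV`, sending `0` to `0`. -/
noncomputable def rv (x : K) : RV v :=
  if hx : x = 0 then 0 else (RVStar.mk v (Units.mk0 x hx) : RV v)

/-- `x ^ (n / p ^ m)`, for integers `n` and `m`, where raising to the power `p` is bijective:
`m`-fold extraction of the `p`-th root of `x ^ n` (and `(-m)`-fold raising to the power `p`
when `m < 0`). -/
noncomputable def fracPow {M : Type*} [CommGroupWithZero M] (p : ℕ)
    (hp : Function.Bijective (fun x : M => x ^ p)) (x : M) (n m : ℤ) : M :=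
  ((MulEquiv.ofBijective (powMonoidHom p : M →* M) hp : MulAut M) ^ (-m)) (x ^ n)

/-- In an algebraically closed field with characteristic exponent `p`, raising to the power `p`
is bijective. -/
theorem pow_bijective_field (K : Type uK) [Field K] [IsAlgClosed K] (p : ℕ) [ExpChar K p] :
    Function.Bijective (fun x : K => x ^ p) :=
  ⟨fun _ _ h => frobenius_inj K p h,
    fun y => IsAlgClosed.exists_pow_nat_eq y (expChar_pos K p)⟩

/-- Over an algebraically closed field with characteristic exponent `p`, raising to the power `p`
is bijective on `RV`. -/
theorem pow_bijective_rv [IsAlgClosed K] (p : ℕ) [ExpChar K p] :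
    Function.Bijective (fun x : RV v => x ^ p) := by
  have hp0 : p ≠ 0 := (expChar_pos K p).ne'
  have key : ∀ u : RVStar v, u ^ p = 1 → u = 1 := by
    intro u hu
    obtain ⟨a, rfl⟩ := RVStar.mk_surjective v u
    rw [← map_pow, RVStar.mk_eq_one_iff] at hu
    rw [RVStar.mk_eq_one_iff]
    have h : ((a ^ p : Kˣ) : K) - 1 = ((a : K) - 1) ^ p := by
      rw [sub_pow_expChar, one_pow, Units.val_pow_eq_pow_val]
    rw [h, v.map_pow] at hu
    by_contra hc
    exact absurd hu (not_lt.2 (nsmul_nonpos (not_lt.1 hc) p))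
  constructor
  · intro x y hxy
    simp only at hxy
    induction x using WithZero.recZeroCoe with
    | zero =>
      rw [zero_pow hp0] at hxy
      exact (eq_zero_of_pow_eq_zero hxy.symm).symm
    | coe a =>
      induction y using WithZero.recZeroCoe with
      | zero =>
        rw [zero_pow hp0] at hxy
        exact eq_zero_of_pow_eq_zero hxy
      | coe b =>
        rw [← WithZero.coe_pow, ← WithZero.coe_pow, WithZero.coe_inj] at hxy
        have := key (a / b) (by rw [div_pow, hxy, div_self'])
        rw [div_eq_one.1 this]
  · intro y
    induction y using WithZero.recZeroCoe with
    | zero => exact ⟨0, zero_pow hp0⟩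
    | coe b =>
      obtain ⟨b, rfl⟩ := RVStar.mk_surjective v b
      obtain ⟨z, hz⟩ := IsAlgClosed.exists_pow_nat_eq (b : K) (expChar_pos K p)
      have hz0 : z ≠ 0 := by
        rintro rfl
        rw [zero_pow hp0] at hz
        exact b.ne_zero hz.symm
      refine ⟨(RVStar.mk v (Units.mk0 z hz0) : RV v), ?_⟩
      simp only
      rw [← WithZero.coe_pow, ← map_pow]
      congr 2
      ext
      simpa using hz

end RV

/-! ### Definability in `K`, `Γ` and `RV*` -/

section Definability

variable {K : Type uK} [Field K] {Γ : Type uG} [AddCommGroup Γ] [LinearOrder Γ]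
  [IsOrderedAddMonoid Γ] (v : AddValuation K (WithTop Γ))
  (L : FirstOrder.Language.{uF, uR}) [L.Structure K]

/-- `S ⊆ K^k` is `L`-definable, with parameters. -/
def DefinableK {k : ℕ} (S : Set (Fin k → K)) : Prop :=
  (univ : Set K).Definable L S

/-- `S ⊆ K^k × K^j` is `L`-definable, with parameters. -/
def DefinableKK {k j : ℕ} (S : Set ((Fin k → K) × (Fin j → K))) : Prop :=
  (univ : Set K).Definable L {z : Fin k ⊕ Fin j → K |
    ((fun i => z (Sum.inl i)), (fun i => z (Sum.inr i))) ∈ S}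

/-- `S ⊆ K^k × Γ^j` is definable (interpretable): its preimage in `K^k × (Kˣ)^j` is `L`-definable,
with parameters. -/
def DefinableKΓ {k j : ℕ} (S : Set ((Fin k → K) × (Fin j → Γ))) : Prop :=
  (univ : Set K).Definable L {z : Fin k ⊕ Fin j → K |
    ∃ γ : Fin j → Γ, (∀ i, v (z (Sum.inr i)) = γ i) ∧ ((fun i => z (Sum.inl i)), γ) ∈ S}

/-- `S ⊆ K^k × RV*` is definable (interpretable): its preimage in `K^k × Kˣ` is `L`-definable,
with parameters. -/
def DefinableKRV {k : ℕ} (S : Set ((Fin k → K) × RVStar v)) : Prop :=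
  (univ : Set K).Definable L {z : Fin k ⊕ Fin 1 → K |
    ∃ c : RVStar v, rv v (z (Sum.inr 0)) = (c : RV v) ∧
      ((fun i => z (Sum.inl i)), c) ∈ S}

/-- The function `f : X ⊆ K^k × K → K` is definable: its graph is a definable set. -/
def DefinableFamily {k : ℕ} (X : Set ((Fin k → K) × K)) (f : (Fin k → K) → K → K) : Prop :=
  DefinableKK L {z : (Fin k → K) × (Fin 2 → K) | (z.1, z.2 0) ∈ X ∧ z.2 1 = f z.1 (z.2 0)}

/-- The function `h : Y ⊆ K^k × Γ → Γ` is definable: its graph is a definable set. -/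
def DefinableΓFamily {k : ℕ} (Y : Set ((Fin k → K) × Γ)) (h : (Fin k → K) → Γ → Γ) : Prop :=
  DefinableKΓ v L {z : (Fin k → K) × (Fin 2 → Γ) | (z.1, z.2 0) ∈ Y ∧ z.2 1 = h z.1 (z.2 0)}

/-- The function `c : W ⊆ K^k → RV*` is definable: its graph is a definable set. -/
def DefinableRVMap {k : ℕ} (W : Set (Fin k → K)) (c : (Fin k → K) → RVStar v) : Prop :=
  DefinableKRV v L {z : (Fin k → K) × RVStar v | z.1 ∈ W ∧ z.2 = c z.1}

/-- The unary `Γ`-function `g : Γ → Γ` is definable. -/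
def DefinableΓFun (g : Γ → Γ) : Prop :=
  DefinableΓFamily v L (univ : Set ((Fin 0 → K) × Γ)) (fun _ => g)

/-- `(K, L)` is definably complete: every definable family `(B_t)_{t ∈ T}` of nested balls whose
set of radii tends to `+∞` has non-empty intersection. -/
def IsDefinablyComplete : Prop :=
  ∀ (k : ℕ) (T : Set (Fin k → K)) (B : (Fin k → K) → Set K),
    DefinableK L T →
    DefinableKK L {z : (Fin k → K) × (Fin 1 → K) | z.1 ∈ T ∧ z.2 0 ∈ B z.1} →
    (∀ t ∈ T, ∃ r, IsBall v (B t) r) →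
    (∀ s ∈ T, ∀ t ∈ T, B s ⊆ B t ∨ B t ⊆ B s) →
    (∀ γ : Γ, ∃ t ∈ T, ∃ r, IsBall v (B t) r ∧ ((γ : WithTop Γ) : WithBot (WithTop Γ)) < r) →
    (⋂ t ∈ T, B t).Nonempty

end Definability

/-! ### Behaviour near infinity -/

section Infinity

variable {K : Type uK} [Field K] {Γ : Type uG} [AddCommGroup Γ] [LinearOrder Γ]
  [IsOrderedAddMonoid Γ] (v : AddValuation K (WithTop Γ))

/-- `P` holds in a neighborhood of infinity, that is, on `K ∖ B(0, γ) = {x | v x < γ}` for some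
`γ ∈ Γ`. -/
def NearInfinity (P : K → Prop) : Prop := ∃ γ : Γ, ∀ x : K, v x < γ → P x

/-- `f : X ⊆ K → K` factorizes at infinity over `Γ` through `h : Y ⊆ Γ → Γ`. -/
def FactorizesAtInfinity (X : Set K) (f : K → K) (Y : Set Γ) (h : Γ → Γ) : Prop :=
  ∃ γ₀ : Γ, ∀ x ∈ X, v x < γ₀ → ∃ γ ∈ Y, v x = γ ∧ v (f x) = h γ

/-- `lim_{x → ∞} F(x) = a`. -/
def HasLimitAtInfinity (F : K → K) (a : K) : Prop :=
  ∀ γ : Γ, ∃ δ : Γ, ∀ x : K, v x < δ → (γ : WithTop Γ) < v (F x - a)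

/-- `g : Γ → Γ` is eventually linear. -/
def EventuallyLinear (g : Γ → Γ) : Prop :=
  ∃ (δ α : Γ) (lam : Γ →+ Γ), ∀ γ : Γ, δ < γ → g γ = lam γ + α

/-- The family `h : Y ⊆ W × Γ → Γ` is eventually `ℚ`-linear towards `-∞` (the values `v x` of the
points `x` near infinity), with finitely many slopes: each `h_w` is of the form
`γ ↦ r γ + α` for all sufficiently small `γ`, with `r` in a finite set independent of `w`.
The equation `h_w(γ) = r γ + α` is written with denominators cleared. -/
def EventuallyQLinearAtInfinity {P : Type*} (W : Set P) (Y : Set (P × Γ)) (h : P → Γ → Γ) : Prop :=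
  ∃ Z : Finset ℚ, ∀ w ∈ W, ∃ r ∈ Z, ∃ δ α : Γ, ∀ γ : Γ, γ < δ →
    (w, γ) ∈ Y ∧ r.den • (h w γ - α) = r.num • γ

end Infinity

/-!
A tame theory has a uniform bound on the number of balls needed to describe the members of a
definable family of subsets of `K`: a family without such a bound would produce, in a countable
ultrapower, a definable set which is not a finite boolean combination of balls. Since the residue
field is infinite, a definable set of residues is thus finite or cofinite, uniformly in families,
and a definable map near infinity with values in the residue field must be constant there. More
generally, a definable map which is invariant under multiplication by units, modulo an equivalence
relation whose classes are balls, is constant near infinity. Since no definable function has a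
valuation which stays positive near infinity but drops below every positive value, a bounded
definable function comes within any given precision of some constant.

If `v (f x) = r • v x + α` near infinity with `r = a / (q * b)` in lowest terms, where `q` is a
prime invertible in `K`, then `f (z ^ q) ^ b / z ^ a` has constant valuation, so it is constant up
to a precision of our choice; but multiplying `z` by a primitive `q`-th root of unity `ζ` multiplies
it by `ζ ^ (-a) ≠ 1`. This works even when `ζ` is congruent to `1`. Hence the denominator of `r` is
a power of `p`. For the factorization itself, with `r = a / n` the function `f x ^ n / x ^ a` has
an eventually constant image in `RV`, which is the `n`-th power of `c`, and `n`-th powers are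
injective on `RV`. Definable completeness turns approximations of `f x / x ^ r` by constants, of
increasing precision, into a limit.
-/

/-! ### Definable predicates and maps -/

/-- An identification of `X` with a finite cartesian power of `K`.  It lets definability be stated
for predicates and maps on iterated products of copies of `K`. -/
class CartesianPower (K : Type uK) (X : Type uK) where
  index : Type
  finite_index : Finite index
  equiv : X ≃ (index → K)

namespace CartesianPower

variable (K : Type uK)

instance (X : Type uK) [CartesianPower K X] : Finite (index K X) := finite_index

instance : CartesianPower K K := ⟨Unit, inferInstance, (Equiv.funUnique Unit K).symm⟩

instance (ι : Type) [Finite ι] : CartesianPower K (ι → K) := ⟨ι, inferInstance, Equiv.refl _⟩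

instance (X Y : Type uK) [CartesianPower K X] [CartesianPower K Y] : CartesianPower K (X × Y) :=
  ⟨index K X ⊕ index K Y, inferInstance,
    (Equiv.prodCongr equiv equiv).trans (Equiv.sumArrowEquivProdArrow _ _ _).symm⟩

end CartesianPower

section Calculus

open CartesianPower

variable {L : FirstOrder.Language.{uF, uR}} {K : Type uK} [L.Structure K]
variable {X Y Z : Type uK} [CartesianPower K X] [CartesianPower K Y] [CartesianPower K Z]

variable (L K) in
/-- A predicate on a cartesian power of `K` is definable with parameters. -/
def DefinablePred (P : X → Prop) : Prop :=
  (univ : Set K).Definable L {z : index K X → K | P (equiv.symm z)}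

variable (L K) in
/-- A map between cartesian powers of `K` is definable with parameters. -/
@[fun_prop]
def DefinableFunction (f : X → Y) : Prop :=
  ∀ i, (univ : Set K).DefinableFun L fun z : index K X → K => equiv (K := K) (f (equiv.symm z)) i

namespace DefinableFunction

@[fun_prop]
theorem id : DefinableFunction L K fun x : X => x := fun i => by
  simpa using Set.DefinableFun.proj L

@[fun_prop]
theorem const (y : Y) : DefinableFunction L K fun _ : X => y := fun _ =>
  L.definableFun_const _ (mem_univ _)

@[fun_prop]
theorem comp {g : Y → Z} {f : X → Y} (hg : DefinableFunction L K g) (hf : DefinableFunction L K f) :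
    DefinableFunction L K fun x => g (f x) := fun i => by
  simpa using Set.DefinableFun.comp (g := fun z => equiv (K := K) (f (equiv.symm z))) hf (hg i)

@[fun_prop]
theorem fst : DefinableFunction L K (Prod.fst : X × Y → X) := fun i =>
  show (univ : Set K).DefinableFun L fun z => (equiv (K := K) ((equiv (K := K)).symm _)) i by
    simp only [Equiv.apply_symm_apply]
    exact Set.DefinableFun.proj L (i := Sum.inl i)

@[fun_prop]
theorem snd : DefinableFunction L K (Prod.snd : X × Y → Y) := fun i =>
  show (univ : Set K).DefinableFun L fun z => (equiv (K := K) ((equiv (K := K)).symm _)) i by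
    simp only [Equiv.apply_symm_apply]
    exact Set.DefinableFun.proj L (i := Sum.inr i)

@[fun_prop]
theorem prodMk {f : X → Y} {g : X → Z} (hf : DefinableFunction L K f)
    (hg : DefinableFunction L K g) :
    DefinableFunction L K fun x => (f x, g x) := fun i =>
  match i with
  | Sum.inl i => hf i
  | Sum.inr i => hg i

@[fun_prop]
theorem apply {ι : Type} [Finite ι] (i : ι) : DefinableFunction L K fun x : ι → K => x i := fun _ =>
  Set.DefinableFun.proj L (i := i)

theorem pi {ι : Type} [Finite ι] {f : X → ι → K} (hf : ∀ i, DefinableFunction L K fun x => f x i) :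
    DefinableFunction L K f := fun i => hf i ()

end DefinableFunction

namespace DefinablePred

variable {P Q : X → Prop}

theorem and (hP : DefinablePred L K P) (hQ : DefinablePred L K Q) :
    DefinablePred L K fun x => P x ∧ Q x :=
  hP.inter hQ

theorem or (hP : DefinablePred L K P) (hQ : DefinablePred L K Q) :
    DefinablePred L K fun x => P x ∨ Q x :=
  hP.union hQ

theorem not (hP : DefinablePred L K P) : DefinablePred L K fun x => ¬ P x :=
  hP.compl

theorem congr (hP : DefinablePred L K P) (h : ∀ x, Q x ↔ P x) : DefinablePred L K Q := by
  rwa [show Q = P from funext fun x => propext (h x)]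

theorem imp (hP : DefinablePred L K P) (hQ : DefinablePred L K Q) :
    DefinablePred L K fun x => P x → Q x :=
  (hP.not.or hQ).congr fun _ => imp_iff_not_or

theorem comp {P : Y → Prop} {f : X → Y} (hP : DefinablePred L K P) (hf : DefinableFunction L K f) :
    DefinablePred L K fun x => P (f x) := by
  have := Set.Definable.preimage_map
    (F := fun z : index K X → K => equiv (K := K) (f (equiv.symm z))) hf hP
  simpa [DefinablePred, Set.preimage] using this

theorem comp₂ {P : Y → Z → Prop} (hP : DefinablePred L K fun q : Y × Z => P q.1 q.2)
    {f : X → Y} {g : X → Z} (hf : DefinableFunction L K f) (hg : DefinableFunction L K g) :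
    DefinablePred L K fun x => P (f x) (g x) :=
  hP.comp (hf.prodMk hg)

theorem ex {P : X → Y → Prop} (hP : DefinablePred L K fun q : X × Y => P q.1 q.2) :
    DefinablePred L K fun x => ∃ y, P x y := by
  have := Set.Definable.exists_of_finite (α := index K X) (β := index K Y) hP
  unfold DefinablePred
  convert this using 1
  ext z
  exact (equiv (K := K) (X := Y)).exists_congr_left

theorem all {P : X → Y → Prop} (hP : DefinablePred L K fun q : X × Y => P q.1 q.2) :
    DefinablePred L K fun x => ∀ y, P x y :=
  (ex (P := fun x y => ¬ P x y) hP.not).not.congr fun _ => not_exists_not.symm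

theorem eq {f g : X → K} (hf : DefinableFunction L K f) (hg : DefinableFunction L K g) :
    DefinablePred L K fun x => f x = g x :=
  Set.DefinableFun.ofPred_eq (hf ()) (hg ())

theorem finite_ex {ι : Type*} [Finite ι] {P : ι → X → Prop} (hP : ∀ i, DefinablePred L K (P i)) :
    DefinablePred L K fun x => ∃ i, P i x := by
  have := Set.definable_iUnion_of_finite hP
  simpa [DefinablePred, Set.iUnion_ofPred] using this

end DefinablePred

theorem DefinableFunction.of_graph {f : X → K}
    (h : DefinablePred L K fun q : X × K => q.2 = f q.1) :
    DefinableFunction L K f := fun i => by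
  have := h.preimage_comp (fun j : index K X ⊕ Unit => Sum.elim some (fun _ => none) j)
  unfold Set.DefinableFun Function.tupleGraph
  convert this using 1
  ext z
  exact eq_comm

end Calculus
/-! ### Uniform bounds on the number of balls -/

section Uniform

open CartesianPower

variable {L : FirstOrder.Language.{uF, uR}} (φ : FirstOrder.Language.LHom Ldiv L)

/-- `x` and `y` have the same position with respect to the closed ball and to the open ball with
centre `q.1` and radius `v q.2`. -/
def SamePosition {M : Type*} [L.Structure M] (q : M × M) (x y : M) : Prop :=
  (divRel φ M q.2 (divSub φ M x q.1) ↔ divRel φ M q.2 (divSub φ M y q.1)) ∧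
    (divRel φ M (divSub φ M x q.1) q.2 ↔ divRel φ M (divSub φ M y q.1) q.2)

/-- Membership in `S` only depends on the position of a point with respect to the balls whose
centres and radii are listed in `l`.  This weak form of being a boolean combination of balls is
first-order in `l`. -/
def ModelTame {M : Type*} [L.Structure M] (l : List (M × M)) (S : Set M) : Prop :=
  ∀ x y, (∀ q ∈ l, SamePosition φ q x y) → (x ∈ S ↔ y ∈ S)

theorem exists_modelTame_of_mem_closure {M : Type*} [L.Structure M] {S : Set M}
    (hS : S ∈ BooleanSubalgebra.closure (modelBalls φ M)) :
    ∃ l : List (M × M), ModelTame φ l S := by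
  induction hS using BooleanSubalgebra.closure_bot_sup_induction with
  | mem S hS =>
    rcases hS with ⟨a, b, rfl⟩ | ⟨a, b, -, rfl⟩ | rfl
    · exact ⟨[(a, b)], fun x y h => (h (a, b) (List.mem_singleton_self _)).1⟩
    · exact ⟨[(a, b)], fun x y h => not_congr (h (a, b) (List.mem_singleton_self _)).2⟩
    · exact ⟨[], fun x y _ => iff_of_true trivial trivial⟩
  | bot => exact ⟨[], fun x y _ => Iff.rfl⟩
  | sup S _ T _ hS hT =>
    obtain ⟨l, hl⟩ := hS
    obtain ⟨l', hl'⟩ := hT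
    exact ⟨l ++ l', fun x y h => or_congr
      (hl x y fun q hq => h q (List.mem_append_left l' hq))
      (hl' x y fun q hq => h q (List.mem_append_right l hq))⟩
  | compl S _ hS =>
    obtain ⟨l, hl⟩ := hS
    exact ⟨l, fun x y h => not_congr (hl x y h)⟩

/-- The formula expressing `SamePosition`; the variables `0`, `1`, `2`, `3` are the centre, the
radius and the two points. -/
def samePositionFormula : L.Formula (Fin 4) :=
  let sub (t : L.Term (Fin 4)) := (φ.onFunction DivFunc.sub).apply₂ t (.var 0)
  let le := (φ.onRelation DivRel.div).formula₂ (α := Fin 4)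
  ((le (.var 1) (sub (.var 2))).iff (le (.var 1) (sub (.var 3)))) ⊓
    ((le (sub (.var 2)) (.var 1)).iff (le (sub (.var 3)) (.var 1)))

theorem realize_samePositionFormula {M : Type*} [L.Structure M] (x : Fin 4 → M) :
    (samePositionFormula φ).Realize x ↔ SamePosition φ (x 0, x 1) (x 2) (x 3) := by
  simp [samePositionFormula, SamePosition, divRel, divSub, Language.Formula.realize_rel₂,
    Language.Formula.realize_iff, Language.Term.realize_functions_apply₂]

theorem samePosition_map_iff {M N : Type*} [L.Structure M] [L.Structure N] (g : M ≃[L] N)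
    (a b x y : M) : SamePosition φ (g a, g b) (g x) (g y) ↔ SamePosition φ (a, b) x y := by
  have := Language.StrongHomClass.realize_formula g (samePositionFormula φ) (v := ![a, b, x, y])
  simp only [realize_samePositionFormula] at this
  exact this

theorem ModelTame.of_equiv {M N : Type*} [L.Structure M] [L.Structure N] (g : M ≃[L] N)
    {l : List (N × N)} {S : Set N} (h : ModelTame φ l S) :
    ModelTame φ (l.map fun q => (g.symm q.1, g.symm q.2)) {x | g x ∈ S} := by
  intro x y hxy
  refine h (g x) (g y) fun q hq => ?_
  have := hxy _ (List.mem_map_of_mem hq)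
  rwa [← samePosition_map_iff φ g, g.apply_symm_apply, g.apply_symm_apply] at this

theorem definable₁_preimage_symm {M N : Type*} [L.Structure M] [L.Structure N] (g : M ≃[L] N)
    {S : Set M} (hS : (univ : Set M).Definable₁ L S) :
    (univ : Set N).Definable₁ L {y | g.symm y ∈ S} := by
  obtain ⟨ψ, hψ⟩ := Set.definable_iff_exists_formula_sum.1 hS
  refine Set.definable_iff_exists_formula_sum.2
    ⟨ψ.relabel (Sum.map (fun a => ⟨g a.1, mem_univ _⟩) id), ?_⟩
  ext x
  have hx := Set.ext_iff.1 hψ fun i => g.symm (x i)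
  simp only [Set.mem_ofPred_eq] at hx ⊢
  rw [hx, Language.Formula.realize_relabel, ← Language.StrongHomClass.realize_formula g]
  refine iff_of_eq (congrArg ψ.Realize (funext fun i => ?_))
  rcases i with i | i
  · rfl
  · exact g.apply_symm_apply (x i)

variable {K : Type uK} [L.Structure K]

theorem IsCMinimal.exists_modelTame_of_elementarilyEquivalent (hC : IsCMinimal φ K)
    {U : Type uK} [L.Structure U] (hU : K ≅[L] U) {S : Set U}
    (hS : (univ : Set U).Definable₁ L S) : ∃ l : List (U × U), ModelTame φ l S := by
  let e : U ≃ ULift.{max uF uR} U := Equiv.ulift.symm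
  let _ : L.Structure (ULift.{max uF uR} U) := e.inducedStructure
  let g : U ≃[L] ULift.{max uF uR} U := e.inducedStructureEquiv
  obtain ⟨l, hl⟩ := exists_modelTame_of_mem_closure φ
    (hC _ (hU.trans (Language.StrongHomClass.elementarilyEquivalent g)) _
      (definable₁_preimage_symm g hS))
  have hgS : {x | g x ∈ {y | g.symm y ∈ S}} = S := by
    ext x
    simp only [Set.mem_ofPred_eq, g.symm_apply_apply]
  exact ⟨_, hgS ▸ hl.of_equiv φ g⟩

variable (K) in
/-- The ultrapower of `K` along a nonprincipal ultrafilter on `ℕ`, in which failures of a uniform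
bound are witnessed by a single definable set. -/
abbrev Ultrapower : Type uK :=
  ((Filter.hyperfilter ℕ : Ultrafilter ℕ) : Filter ℕ).Product fun _ => K

/-- The element of the ultrapower represented by a sequence. -/
noncomputable def Ultrapower.ofSeq (x : ℕ → K) : Ultrapower K := x

theorem Ultrapower.exists_ofSeq_eq (x : Ultrapower K) : ∃ r : ℕ → K, Ultrapower.ofSeq r = x :=
  Quotient.exists_rep x

section Nonempty

variable [Nonempty K]

theorem elementarilyEquivalent_ultrapower : K ≅[L] Ultrapower K :=
  Language.elementarilyEquivalent_iff.2 fun ψ => by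
    rw [Language.Ultraproduct.sentence_realize, Filter.eventually_const]

theorem samePosition_ultrapower_iff (a b x y : ℕ → K) :
    SamePosition φ (Ultrapower.ofSeq a, Ultrapower.ofSeq b) (Ultrapower.ofSeq x)
        (Ultrapower.ofSeq y) ↔
      ∀ᶠ n in (Filter.hyperfilter ℕ : Ultrafilter ℕ),
        SamePosition φ (a n, b n) (x n) (y n) := by
  have := Language.Ultraproduct.realize_formula_cast (u := Filter.hyperfilter ℕ)
    (samePositionFormula φ) ![a, b, x, y]
  simp only [realize_samePositionFormula] at this
  exact this

theorem exists_definable_germ {X : Type uK} [CartesianPower K X] {P : X → K → Prop}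
    (hP : DefinablePred L K fun q : X × K => P q.1 q.2) (t : ℕ → X) :
    ∃ S : Set (Ultrapower K), (univ : Set (Ultrapower K)).Definable₁ L S ∧ ∀ x : ℕ → K,
      Ultrapower.ofSeq x ∈ S ↔
        ∀ᶠ n in (Filter.hyperfilter ℕ : Ultrafilter ℕ), P (t n) (x n) := by
  obtain ⟨ψ, hψ⟩ := Set.definable_iff_exists_formula_sum.1 hP
  have hψP (s : X) (a : K) :
      P s a ↔ ψ.Realize (Sum.elim (↑) (Sum.elim (equiv (K := K) s) fun _ => a)) := by
    have hsa := Set.ext_iff.1 hψ (Sum.elim (equiv (K := K) s) fun _ => a)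
    rw [Set.mem_ofPred_eq, Set.mem_ofPred_eq] at hsa
    rw [← hsa]
    exact iff_of_eq (congrArg₂ P ((equiv (K := K)).symm_apply_apply s).symm rfl)
  let param : (univ : Set K) ⊕ index K X → ℕ → K :=
    Sum.elim (fun a _ => a) fun i n => equiv (K := K) (t n) i
  refine ⟨{x | ψ.Realize (Sum.elim (fun a => .ofSeq (param (.inl a)))
    (Sum.elim (fun i => .ofSeq (param (.inr i))) fun _ => x))}, ?_, fun x => ?_⟩
  · refine Set.definable_iff_exists_formula_sum.2 ⟨ψ.relabel (Sum.elim
      (fun a => .inl ⟨.ofSeq (param (.inl a)), mem_univ _⟩)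
      (Sum.elim (fun i => .inl ⟨.ofSeq (param (.inr i)), mem_univ _⟩) fun _ => .inr 0)), ?_⟩
    ext x
    simp only [Set.mem_ofPred_eq, Language.Formula.realize_relabel]
    refine iff_of_eq (congrArg ψ.Realize (funext fun i => ?_))
    rcases i with i | i | i <;> rfl
  · have hlos := Language.Ultraproduct.realize_formula_cast (u := Filter.hyperfilter ℕ) ψ
      (Sum.elim (fun a => param (.inl a)) (Sum.elim (fun i => param (.inr i)) fun _ => x))
    simp only [hψP]
    refine (iff_of_eq (congrArg ψ.Realize (funext fun i => ?_))).trans (hlos.trans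
      (Filter.eventually_congr (.of_forall fun n =>
        iff_of_eq (congrArg ψ.Realize (funext fun i => ?_))))) <;>
    rcases i with i | i | i <;> rfl

theorem IsCMinimal.exists_list_germ (hC : IsCMinimal φ K) {X : Type uK} [CartesianPower K X]
    {P : X → K → Prop} (hP : DefinablePred L K fun q : X × K => P q.1 q.2) (t : ℕ → X) :
    ∃ l : List (ℕ → K × K), ∀ x y : ℕ → K,
      (∀ q ∈ l, ∀ᶠ n in (Filter.hyperfilter ℕ : Ultrafilter ℕ),
        SamePosition φ (q n) (x n) (y n)) →
      ((∀ᶠ n in (Filter.hyperfilter ℕ : Ultrafilter ℕ), P (t n) (x n)) ↔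
        ∀ᶠ n in (Filter.hyperfilter ℕ : Ultrafilter ℕ), P (t n) (y n)) := by
  obtain ⟨S, hS, hmem⟩ := exists_definable_germ hP t
  obtain ⟨l, hl⟩ := hC.exists_modelTame_of_elementarilyEquivalent φ
    elementarilyEquivalent_ultrapower hS
  choose rep hrep using Ultrapower.exists_ofSeq_eq (K := K)
  refine ⟨l.map fun q n => (rep q.1 n, rep q.2 n), fun x y hxy => ?_⟩
  rw [← hmem, ← hmem]
  refine hl _ _ fun q hq => ?_
  have := (samePosition_ultrapower_iff φ _ _ x y).2 (hxy _ (List.mem_map_of_mem hq))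
  rwa [hrep, hrep] at this

theorem IsCMinimal.exists_uniform_modelTame (hC : IsCMinimal φ K) {X : Type uK}
    [CartesianPower K X] {P : X → K → Prop} (hP : DefinablePred L K fun q : X × K => P q.1 q.2) :
    ∃ N : ℕ, ∀ t, ∃ l : List (K × K), l.length ≤ N ∧ ModelTame φ l {a | P t a} := by
  by_contra! hunbounded
  choose t ht using hunbounded
  obtain ⟨l, hl⟩ := hC.exists_list_germ φ hP t
  have hbad (n : ℕ) : ∃ x y : K, l.length ≤ n →
      (∀ q ∈ l, SamePosition φ (q n) x y) ∧ ¬ (P (t n) x ↔ P (t n) y) := by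
    by_cases hn : l.length ≤ n
    · have hnot := ht n (l.map fun q => q n) (by rwa [List.length_map])
      simp only [ModelTame, List.forall_mem_map, Set.mem_ofPred_eq, not_forall] at hnot
      obtain ⟨x, y, hxy, hne⟩ := hnot
      exact ⟨x, y, fun _ => ⟨hxy, hne⟩⟩
    · obtain ⟨x⟩ := ‹Nonempty K›
      exact ⟨x, x, fun h => absurd h hn⟩
  choose x y hxy using hbad
  have hlarge : ∀ᶠ n in (Filter.hyperfilter ℕ : Ultrafilter ℕ), l.length ≤ n :=
    Nat.hyperfilter_le_atTop (Filter.eventually_ge_atTop _)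
  have hiff : ¬ ∀ᶠ n in (Filter.hyperfilter ℕ : Ultrafilter ℕ), (P (t n) (x n) ↔ P (t n) (y n)) :=
    fun h => by
      obtain ⟨n, hn, hP⟩ := (hlarge.and h).exists
      exact (hxy n hn).2 hP
  refine hiff ?_
  simp only [iff_def, Filter.eventually_and, Ultrafilter.eventually_imp]
  exact iff_def.1 (hl x y fun q hq => hlarge.mono fun n hn => (hxy n hn).1 q hq)

end Nonempty

end Uniform
/-! ### Definability and valuations -/

section DefinableField

variable (L : FirstOrder.Language.{uF, uR}) (K : Type uK) [L.Structure K] [Field K]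

/-- Subtraction and multiplication of `K` are definable. -/
class DefinableField : Prop where
  sub : DefinableFunction L K fun q : K × K => q.1 - q.2
  mul : DefinableFunction L K fun q : K × K => q.1 * q.2

variable {L K} [DefinableField L K] {X : Type uK} [CartesianPower K X]

namespace DefinableFunction

variable {f g : X → K}

@[fun_prop]
theorem sub (hf : DefinableFunction L K f) (hg : DefinableFunction L K g) :
    DefinableFunction L K fun x => f x - g x :=
  DefinableField.sub.comp (hf.prodMk hg)

@[fun_prop]
theorem mul (hf : DefinableFunction L K f) (hg : DefinableFunction L K g) :
    DefinableFunction L K fun x => f x * g x :=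
  DefinableField.mul.comp (hf.prodMk hg)

@[fun_prop]
theorem inv (hf : DefinableFunction L K f) : DefinableFunction L K fun x => (f x)⁻¹ := by
  have h : DefinableFunction L K fun x : K => x⁻¹ := by
    have hzero : DefinablePred L K fun q : K × K => q.1 = 0 ∧ q.2 = 0 :=
      .and (.eq (by fun_prop) (by fun_prop)) (.eq (by fun_prop) (by fun_prop))
    have hone : DefinablePred L K fun q : K × K => q.1 * q.2 = 1 :=
      .eq (.mul (by fun_prop) (by fun_prop)) (by fun_prop)
    refine DefinableFunction.of_graph ((hzero.or hone).congr fun q => ?_)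
    by_cases h : q.1 = 0
    · simp [h]
    · simp only [h, false_and, false_or]
      exact ⟨fun e => e ▸ mul_inv_cancel₀ h, eq_inv_of_mul_eq_one_right⟩
  exact h.comp hf

@[fun_prop]
theorem div (hf : DefinableFunction L K f) (hg : DefinableFunction L K g) :
    DefinableFunction L K fun x => f x / g x := by
  simp only [div_eq_mul_inv]
  fun_prop

@[fun_prop]
theorem pow (hf : DefinableFunction L K f) (n : ℕ) : DefinableFunction L K fun x => f x ^ n := by
  induction n with
  | zero => simpa using DefinableFunction.const 1
  | succ n ih => simpa only [pow_succ] using ih.mul hf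

@[fun_prop]
theorem zpow (hf : DefinableFunction L K f) (n : ℤ) : DefinableFunction L K fun x => f x ^ n := by
  cases n with
  | ofNat n => simpa using hf.pow n
  | negSucc n => simpa only [zpow_negSucc] using (hf.pow (n + 1)).inv

end DefinableFunction

end DefinableField

section Valued

variable {K : Type uK} [Field K] {Γ : Type uG} [AddCommGroup Γ] [LinearOrder Γ]
  [IsOrderedAddMonoid Γ] {v : AddValuation K (WithTop Γ)}

theorem val_ne_top {c : K} (hc : c ≠ 0) : v c ≠ ⊤ := v.ne_top_iff.2 hc

theorem exists_val_eq_coe {c : K} (hc : c ≠ 0) : ∃ γ : Γ, v c = γ :=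
  ⟨(v c).untop (val_ne_top hc), by simp⟩

theorem ne_zero_of_val_lt {x : K} {y : WithTop Γ} (h : v x < y) : x ≠ 0 := by
  rintro rfl
  simp at h

theorem ne_zero_of_val_eq_coe {x : K} {γ : Γ} (h : v x = γ) : x ≠ 0 := by
  rintro rfl
  simp at h

theorem ne_zero_of_val_eq_zero {x : K} (h : v x = 0) : x ≠ 0 :=
  ne_zero_of_val_eq_coe (γ := 0) h

theorem val_mul_le_val_mul_iff {c a b : K} (hc : c ≠ 0) : v (c * a) ≤ v (c * b) ↔ v a ≤ v b := by
  rw [v.map_mul, v.map_mul]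
  exact WithTop.add_le_add_iff_left (val_ne_top hc)

theorem val_mul_lt_val_mul_iff {c a b : K} (hc : c ≠ 0) : v (c * a) < v (c * b) ↔ v a < v b :=
  lt_iff_lt_of_le_iff_le (val_mul_le_val_mul_iff hc)

theorem val_mul_eq_val_mul_iff {c a b : K} (hc : c ≠ 0) : v (c * a) = v (c * b) ↔ v a = v b := by
  simp only [le_antisymm_iff, val_mul_le_val_mul_iff hc]

theorem val_le_val_mul_iff {c a : K} (hc : c ≠ 0) : v c ≤ v (c * a) ↔ 0 ≤ v a := by
  simpa using val_mul_le_val_mul_iff (v := v) (a := 1) (b := a) hc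

theorem val_lt_val_mul_iff {c a : K} (hc : c ≠ 0) : v c < v (c * a) ↔ 0 < v a := by
  simpa using val_mul_lt_val_mul_iff (v := v) (a := 1) (b := a) hc

theorem val_div_nonneg_iff {c a : K} (hc : c ≠ 0) : 0 ≤ v (a / c) ↔ v c ≤ v a := by
  rw [← val_le_val_mul_iff hc, mul_div_cancel₀ _ hc]

theorem val_div_pos_iff {c a : K} (hc : c ≠ 0) : 0 < v (a / c) ↔ v c < v a := by
  rw [← val_lt_val_mul_iff hc, mul_div_cancel₀ _ hc]

theorem val_div_eq_zero_iff {c a : K} (hc : c ≠ 0) : v (a / c) = 0 ↔ v a = v c := by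
  rw [← v.map_one, ← val_mul_eq_val_mul_iff hc, mul_div_cancel₀ _ hc, mul_one]

theorem le_val_sub_trans {x y z : K} {γ : WithTop Γ} (h : γ ≤ v (x - y)) (h' : γ ≤ v (y - z)) :
    γ ≤ v (x - z) := by
  rw [← sub_add_sub_cancel x y z]
  exact v.map_le_add h h'

theorem lt_val_sub_trans {x y z : K} {γ : WithTop Γ} (h : γ < v (x - y)) (h' : γ < v (y - z)) :
    γ < v (x - z) := by
  rw [← sub_add_sub_cancel x y z]
  exact v.map_lt_add h h'

end Valued

section InfFilter

variable {K : Type uK} [Field K] {Γ : Type uG} [AddCommGroup Γ] [LinearOrder Γ]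
  [IsOrderedAddMonoid Γ]

/-- The filter of neighborhoods of infinity. -/
def infFilter (v : AddValuation K (WithTop Γ)) : Filter K :=
  ⨅ γ : Γ, Filter.principal {x | v x < γ}

variable {v : AddValuation K (WithTop Γ)}

theorem eventually_infFilter {P : K → Prop} : (∀ᶠ x in infFilter v, P x) ↔ NearInfinity v P := by
  unfold infFilter NearInfinity
  rw [Filter.Eventually, Filter.mem_iInf_of_directed]
  · simp [Set.subset_def]
  · intro γ δ
    refine ⟨min γ δ, Filter.principal_mono.2 fun x hx => ?_,
      Filter.principal_mono.2 fun x hx => ?_⟩ <;>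
      simp only [Set.mem_ofPred_eq, WithTop.coe_min, lt_min_iff] at hx ⊢
    exacts [hx.1, hx.2]

theorem eventually_val_lt_coe (γ : Γ) : ∀ᶠ x in infFilter v, v x < γ :=
  eventually_infFilter.2 ⟨γ, fun _ => id⟩

theorem eventually_val_lt (c : K) : ∀ᶠ x in infFilter v, v x < v c := by
  by_cases hc : c = 0
  · filter_upwards [eventually_val_lt_coe (v := v) 0] with x hx
    rw [hc, v.map_zero]
    exact hx.trans (WithTop.coe_lt_top _)
  · obtain ⟨γ, hγ⟩ := exists_val_eq_coe (v := v) hc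
    rw [hγ]
    exact eventually_val_lt_coe γ

theorem eventually_ne_zero : ∀ᶠ z in infFilter v, z ≠ 0 := by
  filter_upwards [eventually_val_lt_coe (v := v) 0] with z hz using ne_zero_of_val_lt hz

theorem eventually_mul_left {P : K → Prop} (hP : ∀ᶠ z in infFilter v, P z) {c : K} (hc : c ≠ 0) :
    ∀ᶠ z in infFilter v, P (c * z) := by
  obtain ⟨γ, hγ⟩ := eventually_infFilter.1 hP
  obtain ⟨δ, hδ⟩ := exists_val_eq_coe (v := v) hc
  refine eventually_infFilter.2 ⟨γ - δ, fun x hx => hγ _ ?_⟩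
  obtain ⟨ε, hε⟩ := exists_val_eq_coe (v := v) (ne_zero_of_val_lt hx)
  rw [hε, WithTop.coe_lt_coe] at hx
  rw [v.map_mul, hδ, hε, ← WithTop.coe_add, WithTop.coe_lt_coe]
  exact lt_sub_iff_add_lt'.1 hx

theorem eventually_infFilter_iff (hv : Function.Surjective v) {P : K → Prop} :
    (∀ᶠ x in infFilter v, P x) ↔ ∃ g ≠ 0, ∀ x, v x < v g → P x := by
  constructor
  · intro h
    obtain ⟨γ, h⟩ := eventually_infFilter.1 h
    obtain ⟨g, hg⟩ := hv γ
    exact ⟨g, ne_zero_of_val_eq_coe hg, fun x hx => h x (hg ▸ hx)⟩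
  · rintro ⟨g, -, h⟩
    exact (eventually_val_lt g).mono h

theorem infFilter_neBot [Nontrivial Γ] (hv : Function.Surjective v) : (infFilter v).NeBot := by
  refine ⟨fun h => ?_⟩
  obtain ⟨γ, hγ⟩ := eventually_infFilter.1 (Filter.empty_mem_iff_bot.2 h)
  obtain ⟨δ, hδ⟩ := exists_lt γ
  obtain ⟨x, hx⟩ := hv δ
  exact hγ x (by rw [hx]; exact WithTop.coe_lt_coe.2 hδ)

end InfFilter
/-! ### Residues and tame sets -/

section Residue

variable {K : Type uK} [Field K] {Γ : Type uG} [AddCommGroup Γ] [LinearOrder Γ]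
  [IsOrderedAddMonoid Γ]

theorem exists_list_prod_sub_eq_one [IsAlgClosed K] {F : List K} (hF : F ≠ []) :
    ∃ a, (F.map fun b => a - b).prod = 1 := by
  obtain ⟨a, ha⟩ := IsAlgClosed.eval_surjective
    (p := ((F : Multiset K).map fun b => Polynomial.X - Polynomial.C b).prod)
    (by rw [Polynomial.natDegree_multiset_prod_X_sub_C_eq_card]; simpa using hF) 1
  beta_reduce at ha
  rw [Polynomial.eval_multiset_prod] at ha
  exact ⟨a, by simpa [Function.comp_def] using ha⟩

theorem val_list_prod (v : AddValuation K (WithTop Γ)) (l : List K) :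
    v l.prod = (l.map v).sum := by
  induction l with
  | nil => simp
  | cons a l ih => simp [v.map_mul, ih]

theorem exists_generic_of_integral [IsAlgClosed K] (v : AddValuation K (WithTop Γ)) {F : List K}
    (hne : F ≠ []) (hF : ∀ b ∈ F, 0 ≤ v b) : ∃ a, 0 ≤ v a ∧ ∀ b ∈ F, v (a - b) = 0 := by
  obtain ⟨a, ha⟩ := exists_list_prod_sub_eq_one hne
  have hsum : ((F.map fun b => a - b).map v).sum = 0 := by rw [← val_list_prod, ha, v.map_one]
  have ha0 : 0 ≤ v a := by
    by_contra! hneg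
    have hle := List.sum_le_card_nsmul ((F.map fun b => a - b).map v) (v a) (by
      simp only [List.map_map, List.mem_map, Function.comp_apply]
      rintro _ ⟨b, hb, rfl⟩
      exact (v.map_sub_eq_of_lt_left (hneg.trans_le (hF b hb))).le)
    obtain ⟨n, hn⟩ := Nat.exists_eq_succ_of_ne_zero (List.length_pos_iff.2 hne).ne'
    rw [hsum, List.length_map, List.length_map, hn, succ_nsmul] at hle
    exact hle.not_gt ((add_le_of_nonpos_left (nsmul_nonpos hneg.le n)).trans_lt hneg)
  refine ⟨a, ha0, fun b hb => List.all_zero_of_le_zero_le_of_sum_eq_zero ?_ hsum ?_⟩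
  · simp only [List.map_map, List.mem_map, Function.comp_apply]
    rintro _ ⟨b, hb, rfl⟩
    exact v.map_le_sub ha0 (hF b hb)
  · exact List.mem_map_of_mem (List.mem_map_of_mem hb)

/-- The residue field of an algebraically closed valued field is infinite. -/
theorem exists_generic [IsAlgClosed K] (v : AddValuation K (WithTop Γ)) (F : List K) :
    ∃ a, v a = 0 ∧ ∀ b ∈ F, v (a - b) ≤ 0 := by
  obtain ⟨a, ha0, ha⟩ := exists_generic_of_integral v
    (F := 0 :: F.filter fun b => 0 ≤ v b) (by simp) (by simp)
  simp only [List.mem_cons, forall_eq_or_imp, List.mem_filter, decide_eq_true_eq, sub_zero] at ha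
  refine ⟨a, ha.1, fun b hb => ?_⟩
  rcases le_or_gt 0 (v b) with h | h
  · exact (ha.2 b ⟨hb, h⟩).le
  · rw [v.map_sub_eq_of_lt_right (h.trans_le ha0)]
    exact h.le

variable {v : AddValuation K (WithTop Γ)}

theorem exists_generic_mul [IsAlgClosed K] (F : List K) {c : K} (hc : v c = 0) :
    ∃ a b, c = a * b ∧ v a = 0 ∧ v b = 0 ∧
      (∀ x ∈ F, v (a - x) ≤ 0) ∧ ∀ x ∈ F, v (b - x) ≤ 0 := by
  obtain ⟨a, ha, haF⟩ := exists_generic v (F ++ F.map fun x => c / x)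
  simp only [List.mem_append, List.mem_map, or_imp, forall_and, forall_exists_index, and_imp,
    forall_apply_eq_imp_iff₂] at haF
  have ha0 := ne_zero_of_val_eq_zero ha
  have hb : v (c / a) = 0 := by rw [val_div_eq_zero_iff ha0, hc, ha]
  refine ⟨a, c / a, (mul_div_cancel₀ c ha0).symm, ha, hb, haF.1, fun x hx => ?_⟩
  by_contra! hlt
  have hvx : v x = 0 := by
    rw [← hb]
    exact v.map_eq_of_lt_sub (by rwa [v.map_sub_swap, hb])
  have hx0 := ne_zero_of_val_eq_zero hvx
  refine (haF.2 x hx).not_gt ?_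
  rw [show a - c / x = -(a * ((c / a - x) / x)) by field_simp; ring, v.map_neg, v.map_mul, ha,
    zero_add, val_div_pos_iff hx0, hvx]
  exact hlt

theorem exists_distinct_residues {A : K → Prop}
    (h : ∀ F : List K, ∃ a, A a ∧ ∀ b ∈ F, v (a - b) ≤ 0) (n : ℕ) :
    ∃ a : Fin n → K, (∀ i, A (a i)) ∧ Pairwise fun i j => v (a i - a j) ≤ 0 := by
  induction n with
  | zero => exact ⟨Fin.elim0, fun i => i.elim0, fun i => i.elim0⟩
  | succ n ih =>
    obtain ⟨a, ha, haa⟩ := ih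
    obtain ⟨b, hb, hba⟩ := h (List.ofFn a)
    replace hba : ∀ i, v (b - a i) ≤ 0 := fun i => hba _ (by simp)
    refine ⟨Fin.cons b a, fun i => ?_, ?_⟩
    · cases i using Fin.cases <;> simp [ha, hb]
    · refine Fin.cases (Fin.cases (by simp) fun j _ => by simpa using hba j) fun i =>
        Fin.cases (fun _ => ?_) fun j hij => ?_
      · simpa [v.map_sub_swap (a i) b] using hba i
      · simpa using haa (by simpa using hij)

theorem exists_residue_avoiding {ι : Type*} {a : ι → K}
    (haa : Pairwise fun i j => v (a i - a j) ≤ 0) {F : List K} {s : Finset ι}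
    (hF : F.length < s.card) : ∃ i ∈ s, ∀ b ∈ F, v (a i - b) ≤ 0 := by
  classical
  by_contra! hcon
  choose! b hbF hb using hcon
  obtain ⟨i, hi, j, hj, hij, hbij⟩ := Finset.exists_ne_map_eq_of_card_lt_of_maps_to (s := s)
    (t := F.toFinset) (f := b) ((List.toFinset_card_le F).trans_lt hF)
    fun i hi => by simpa using hbF i hi
  refine (haa hij).not_gt (lt_val_sub_trans (hb i hi) ?_)
  rw [hbij, v.map_sub_swap]
  exact hb j hj

end Residue

section Tame

variable {K : Type uK} [Field K] {Γ : Type uG} [AddCommGroup Γ] [LinearOrder Γ]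
  [IsOrderedAddMonoid Γ]

/-- Membership in `S` only depends on the position of a point with respect to the balls whose
centres and radii are listed in `l`; the radius of `(c, r)` is `v r`. -/
def Tame (v : AddValuation K (WithTop Γ)) (l : List (K × K)) (S : Set K) : Prop :=
  ∀ x y, (∀ q ∈ l, (v q.2 ≤ v (x - q.1) ↔ v q.2 ≤ v (y - q.1)) ∧
    (v (x - q.1) ≤ v q.2 ↔ v (y - q.1) ≤ v q.2)) → (x ∈ S ↔ y ∈ S)

open Classical in
/-- The valuations of the centres and radii listed in `l`. -/
noncomputable def criticalValues (v : AddValuation K (WithTop Γ)) (l : List (K × K)) :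
    Finset (WithTop Γ) :=
  (l.map fun q => v q.1).toFinset ∪ (l.map fun q => v q.2).toFinset

variable {v : AddValuation K (WithTop Γ)} {l : List (K × K)} {S : Set K}

theorem mem_criticalValues {γ : WithTop Γ} :
    γ ∈ criticalValues v l ↔ (∃ q ∈ l, v q.1 = γ) ∨ ∃ q ∈ l, v q.2 = γ := by
  simp [criticalValues]

namespace Tame

theorem mem_iff_of_forall_eq (h : Tame v l S) {x y : K}
    (hxy : ∀ q ∈ l, v (x - q.1) = v (y - q.1)) : x ∈ S ↔ y ∈ S :=
  h x y fun q hq => by rw [hxy q hq]; exact ⟨Iff.rfl, Iff.rfl⟩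

theorem mem_iff_of_generic (h : Tame v l S) {a b : K} (ha : 0 ≤ v a) (hb : 0 ≤ v b)
    (ha' : ∀ q ∈ l, v (a - q.1) ≤ 0) (hb' : ∀ q ∈ l, v (b - q.1) ≤ 0) : a ∈ S ↔ b ∈ S := by
  refine h.mem_iff_of_forall_eq fun q hq => ?_
  rcases le_or_gt 0 (v q.1) with hc | hc
  · rw [le_antisymm (ha' q hq) (v.map_le_sub ha hc), le_antisymm (hb' q hq) (v.map_le_sub hb hc)]
  · rw [v.map_sub_eq_of_lt_right (hc.trans_le ha), v.map_sub_eq_of_lt_right (hc.trans_le hb)]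

theorem mem_iff_of_criticalValues (h : Tame v l S) {a b : K} (hab : v a ≤ v b)
    (hc : ∀ γ ∈ criticalValues v l, γ < v a ∨ v b < γ) : a ∈ S ↔ b ∈ S := by
  refine h a b fun q hq => ?_
  rcases hc _ (mem_criticalValues.2 (.inl ⟨q, hq, rfl⟩)) with h1 | h1
  · rw [v.map_sub_eq_of_lt_right h1, v.map_sub_eq_of_lt_right (h1.trans_le hab)]
    exact ⟨Iff.rfl, Iff.rfl⟩
  · rw [v.map_sub_eq_of_lt_left (hab.trans_lt h1), v.map_sub_eq_of_lt_left h1]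
    rcases hc _ (mem_criticalValues.2 (.inr ⟨q, hq, rfl⟩)) with h2 | h2
    · exact ⟨iff_of_true h2.le (h2.le.trans hab),
        iff_of_false h2.not_ge (h2.trans_le hab).not_ge⟩
    · exact ⟨iff_of_false (hab.trans_lt h2).not_ge h2.not_ge,
        iff_of_true (hab.trans h2.le) h2.le⟩

end Tame

end Tame
section UniformlyTame

variable (L : FirstOrder.Language.{uF, uR}) {K : Type uK} [L.Structure K] [Field K]
  {Γ : Type uG} [AddCommGroup Γ] [LinearOrder Γ] [IsOrderedAddMonoid Γ]
  (v : AddValuation K (WithTop Γ))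

/-- A valued field with surjective definable valuation in which definable families of unary sets
are uniformly tame. -/
class UniformlyTame : Prop where
  surjective : Function.Surjective v
  le : DefinablePred L K fun q : K × K => v q.1 ≤ v q.2
  tame : ∀ {X : Type uK} [CartesianPower K X] {P : X → K → Prop},
    (DefinablePred L K fun q : X × K => P q.1 q.2) →
      ∃ N : ℕ, ∀ t, ∃ l : List (K × K), l.length ≤ N ∧ Tame v l {a | P t a}

variable {L v} [UniformlyTame L v] {X : Type uK} [CartesianPower K X]

namespace DefinablePred

variable {f g : X → K}

theorem val_le (hf : DefinableFunction L K f) (hg : DefinableFunction L K g) :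
    DefinablePred L K fun x => v (f x) ≤ v (g x) :=
  UniformlyTame.le.comp (hf.prodMk hg)

theorem val_lt (hf : DefinableFunction L K f) (hg : DefinableFunction L K g) :
    DefinablePred L K fun x => v (f x) < v (g x) :=
  (val_le hg hf).not.congr fun _ => not_le.symm

theorem val_eq (hf : DefinableFunction L K f) (hg : DefinableFunction L K g) :
    DefinablePred L K fun x => v (f x) = v (g x) :=
  ((val_le hf hg).and (val_le hg hf)).congr fun _ => le_antisymm_iff

theorem val_pos (hf : DefinableFunction L K f) : DefinablePred L K fun x => 0 < v (f x) :=
  (val_lt (v := v) (g := f) (.const 1) hf).congr fun _ => by simp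

theorem eventually {P : X → K → Prop} (hP : DefinablePred L K fun q : X × K => P q.1 q.2) :
    DefinablePred L K fun x => ∀ᶠ z in infFilter v, P x z := by
  refine congr ?_ fun x => eventually_infFilter_iff (UniformlyTame.surjective L)
  exact ex (Y := K) (and (not (eq (by fun_prop) (by fun_prop))) (all (Y := K) (imp
    (val_lt (by fun_prop) (by fun_prop)) (hP.comp₂ (by fun_prop) (by fun_prop)))))

theorem exists_tame {P : K → Prop} (hP : DefinablePred L K P) :
    ∃ l : List (K × K), Tame v l {a | P a} := by
  obtain ⟨N, hN⟩ := UniformlyTame.tame (L := L) (v := v) (P := fun _ : K => P)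
    (hP.comp (f := fun q : K × K => q.2) (by fun_prop))
  obtain ⟨l, -, hl⟩ := hN 0
  exact ⟨l, hl⟩

theorem eventually_or_eventually_not {P : K → Prop} (hP : DefinablePred L K P) :
    (∀ᶠ x in infFilter v, P x) ∨ ∀ᶠ x in infFilter v, ¬ P x := by
  obtain ⟨l, hl⟩ := hP.exists_tame (v := v)
  have hfar : ∀ᶠ x in infFilter v, ∀ γ ∈ criticalValues v l, v x < γ := by
    refine (Filter.eventually_all_finset _).2 fun γ hγ => ?_
    rcases mem_criticalValues.1 hγ with ⟨q, -, rfl⟩ | ⟨q, -, rfl⟩ <;> exact eventually_val_lt _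
  by_cases h : ∃ x, (∀ γ ∈ criticalValues v l, v x < γ) ∧ P x
  · obtain ⟨x, hx, hPx⟩ := h
    refine .inl (hfar.mono fun y hy => ?_)
    rcases le_total (v x) (v y) with hxy | hxy
    · exact (hl.mem_iff_of_criticalValues hxy fun γ hγ => .inr (hy γ hγ)).1 hPx
    · exact (hl.mem_iff_of_criticalValues hxy fun γ hγ => .inr (hx γ hγ)).2 hPx
  · exact .inr (hfar.mono fun y hy hPy => h ⟨y, hy, hPy⟩)

theorem eventually_of_frequently {P : K → Prop} (hP : DefinablePred L K P)
    (h : ∃ᶠ x in infFilter v, P x) : ∀ᶠ x in infFilter v, P x :=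
  (hP.eventually_or_eventually_not (v := v)).resolve_right h

/-- In terms of residues: a definable subset of the residue field is finite or cofinite, uniformly
in definable families. -/
theorem generic_or_generic_not {P : X → K → Prop}
    (hP : DefinablePred L K fun q : X × K => P q.1 q.2) :
    ∃ N : ℕ, ∀ t, ∃ F : List K, F.length ≤ N ∧
      ((∀ a, 0 ≤ v a → (∀ c ∈ F, v (a - c) ≤ 0) → P t a) ∨
        ∀ a, 0 ≤ v a → (∀ c ∈ F, v (a - c) ≤ 0) → ¬ P t a) := by
  obtain ⟨N, hN⟩ := UniformlyTame.tame (v := v) hP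
  refine ⟨N, fun t => ?_⟩
  obtain ⟨l, hlN, hl⟩ := hN t
  refine ⟨l.map Prod.fst, by simpa using hlN, ?_⟩
  by_contra! hcon
  obtain ⟨⟨a, ha, haF, hPa⟩, ⟨b, hb, hbF, hPb⟩⟩ := hcon
  exact hPa ((hl.mem_iff_of_generic ha hb (fun q hq => haF _ (List.mem_map_of_mem hq))
    fun q hq => hbF _ (List.mem_map_of_mem hq)).2 hPb)

theorem exists_card_le_or_card_le {P : X → K → Prop}
    (hP : DefinablePred L K fun q : X × K => P q.1 q.2) :
    ∃ N : ℕ, ∀ (t : X) {n : ℕ} (a : Fin n → K) (s : Finset (Fin n)), (∀ i, 0 ≤ v (a i)) →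
      (Pairwise fun i j => v (a i - a j) ≤ 0) → (∀ i, i ∈ s ↔ P t (a i)) →
        s.card ≤ N ∨ sᶜ.card ≤ N := by
  obtain ⟨N, hN⟩ := hP.generic_or_generic_not (v := v)
  refine ⟨N, fun t n a s ha haa hs => ?_⟩
  obtain ⟨F, hFN, hF⟩ := hN t
  by_contra! hcard
  rcases hF with hF | hF
  · obtain ⟨i, hi, hiF⟩ := exists_residue_avoiding haa (hFN.trans_lt hcard.2)
    exact Finset.mem_compl.1 hi ((hs i).2 (hF _ (ha i) hiF))
  · obtain ⟨i, hi, hiF⟩ := exists_residue_avoiding haa (hFN.trans_lt hcard.1)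
    exact hF _ (ha i) hiF ((hs i).1 hi)

end DefinablePred

end UniformlyTame

section Order

variable {α : Type*} [LinearOrder α]

theorem exists_pair_avoiding (C : Finset α) {V W : Set α} (hV : V.Nonempty)
    (hVW : ∀ x ∈ V, ∃ y ∈ W, y < x) (hWV : ∀ y ∈ W, ∃ x ∈ V, x < y) :
    ∃ x ∈ V, ∃ y ∈ W, y < x ∧ ∀ c ∈ C, c < y ∨ x < c := by
  classical
  obtain ⟨x, hx, hmin⟩ := (measure fun x => (C.filter (· ≤ x)).card).wf.has_min V hV
  obtain ⟨y, hy, hyx⟩ := hVW x hx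
  obtain ⟨z, hz, hzy⟩ := hWV y hy
  refine ⟨x, hx, y, hy, hyx, fun c hc => ?_⟩
  by_contra! hcon
  refine hmin z hz (Finset.card_lt_card ((Finset.ssubset_iff_of_subset fun d hd => ?_).2
    ⟨c, Finset.mem_filter.2 ⟨hc, hcon.2⟩, fun h => ?_⟩))
  · obtain ⟨hdC, hdz⟩ := Finset.mem_filter.1 hd
    exact Finset.mem_filter.2 ⟨hdC, hdz.trans (hzy.trans hyx).le⟩
  · exact ((Finset.mem_filter.1 h).2.trans_lt hzy).not_ge hcon.1

theorem exists_endpoint_of_isLowerSet {C : Finset α} {A : Set α} (hA : IsLowerSet A)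
    (hne : A.Nonempty) (hne' : Aᶜ.Nonempty) (hC : ∀ x ∈ A, ∀ y ∉ A, ∃ γ ∈ C, x ≤ γ ∧ γ ≤ y) :
    ∃ γ ∈ C, (∀ x < γ, x ∈ A) ∧ ∀ x, γ < x → x ∉ A := by
  classical
  by_cases hD : ∃ γ ∈ C, γ ∉ A ∧ ∀ x < γ, x ∈ A
  · obtain ⟨γ, hγ, hγA, hlow⟩ := hD
    exact ⟨γ, hγ, hlow, fun x hx hxA => hγA (hA hx.le hxA)⟩
  · push Not at hD
    obtain ⟨y, hy, hyC⟩ : ∃ y ∉ A, ∀ γ ∈ C, γ ∉ A → y < γ := by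
      rcases (C.filter (· ∉ A)).eq_empty_or_nonempty with h | h
      · obtain ⟨y, hy⟩ := hne'
        exact ⟨y, hy, fun γ hγ hγA => absurd hγA (Finset.filter_eq_empty_iff.1 h hγ)⟩
      · obtain ⟨m, hm, hmin⟩ := Finset.exists_min_image _ id h
        obtain ⟨hmC, hmA⟩ := Finset.mem_filter.1 hm
        obtain ⟨y, hym, hyA⟩ := hD m hmC hmA
        exact ⟨y, hyA, fun γ hγ hγA => hym.trans_le (hmin γ (Finset.mem_filter.2 ⟨hγ, hγA⟩))⟩
    have hbelow : ∀ x ∈ A, ∃ γ ∈ C.filter (· ∈ A), x ≤ γ := by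
      intro x hx
      obtain ⟨γ, hγ, hxγ, hγy⟩ := hC x hx y hy
      exact ⟨γ, Finset.mem_filter.2 ⟨hγ, by_contra fun h => (hyC γ hγ h).not_ge hγy⟩, hxγ⟩
    obtain ⟨m, hm, hmax⟩ := Finset.exists_max_image (C.filter (· ∈ A)) id
      (hne.elim fun x hx => (hbelow x hx).imp fun γ h => h.1)
    obtain ⟨hmC, hmA⟩ := Finset.mem_filter.1 hm
    refine ⟨m, hmC, fun x hx => hA hx.le hmA, fun x hx hxA => ?_⟩
    obtain ⟨γ, hγ, hxγ⟩ := hbelow x hxA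
    exact (hx.trans_le hxγ).not_ge (hmax γ hγ)

end Order

theorem exists_card_filter_eq {α : Type*} [Fintype α] (r : α → α → Prop) [DecidableRel r]
    [IsStrictTotalOrder α r] {k : ℕ} (hk : k < Fintype.card α) :
    ∃ a, (Finset.univ.filter (r a)).card = k := by
  have hmono : ∀ a b, r a b → (Finset.univ.filter (r b)).card < (Finset.univ.filter (r a)).card :=
    fun a b hab => Finset.card_lt_card ((Finset.ssubset_iff_of_subset fun c hc => by
      simpa using _root_.trans hab (by simpa using hc)).2
        ⟨b, by simpa using hab, by simpa using irrefl b⟩)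
  have hlt : ∀ a, (Finset.univ.filter (r a)).card < Fintype.card α := fun a =>
    Finset.card_lt_card (Finset.ssubset_univ_iff.2 fun h =>
      irrefl (r := r) a (by simpa using Finset.eq_univ_iff_forall.1 h a))
  have hinj : Function.Injective fun a => (⟨_, hlt a⟩ : Fin (Fintype.card α)) := fun a b hab => by
    rw [Fin.mk.injEq] at hab
    rcases trichotomous_of r a b with h | h | h
    · exact absurd hab (hmono a b h).ne'
    · exact h
    · exact absurd hab (hmono b a h).ne
  obtain ⟨a, ha⟩ := ((Fintype.bijective_iff_injective_and_card _).2 ⟨hinj, by simp⟩).2 ⟨k, hk⟩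
  exact ⟨a, congrArg Fin.val ha⟩

section ReachesBelow

variable {L : FirstOrder.Language.{uF, uR}} {K : Type uK} [L.Structure K] [Field K]
  {Γ : Type uG} [AddCommGroup Γ] [LinearOrder Γ] [IsOrderedAddMonoid Γ]
  {v : AddValuation K (WithTop Γ)}

theorem exists_endpoint [UniformlyTame L v] {R : K → Prop} (hR : DefinablePred L K R)
    (hdown : ∀ b b', v b' ≤ v b → R b → R b') {b₀ b₁ : K} (h₀ : R b₀) (h₁ : ¬ R b₁)
    (hb₁ : b₁ ≠ 0) : ∃ r ≠ 0, (∀ b, v b < v r → R b) ∧ ∀ b, v r < v b → ¬ R b := by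
  obtain ⟨l, hl⟩ := hR.exists_tame (v := v)
  have hmem : ∀ b, v b ∈ v '' {b | R b} ↔ R b := fun b =>
    ⟨fun ⟨b', hb', h⟩ => hdown b' b h.ge hb', fun hb => ⟨b, hb, rfl⟩⟩
  have hsurj : Function.Surjective v := UniformlyTame.surjective L
  obtain ⟨γ, hγ, hlow, hhigh⟩ := exists_endpoint_of_isLowerSet
    (C := criticalValues v l) (A := v '' {b | R b})
    (hsurj.forall₂.2 fun b b' h hb => (hmem b').2 (hdown b b' h ((hmem b).1 hb)))
    ⟨v b₀, (hmem b₀).2 h₀⟩ ⟨v b₁, mt (hmem b₁).1 h₁⟩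
    (hsurj.forall.2 fun x hx => hsurj.forall.2 fun y hy => by
      rw [hmem] at hx hy
      by_contra! hno
      have hxy : v x ≤ v y := (lt_of_not_ge fun h => hy (hdown x y h hx)).le
      exact hy ((hl.mem_iff_of_criticalValues hxy fun γ hγ =>
        (lt_or_ge γ (v x)).imp_right (hno γ hγ)).1 hx))
  obtain ⟨r, rfl⟩ := hsurj γ
  refine ⟨r, ?_, fun b hb => (hmem b).1 (hlow _ hb), fun b hb => mt (hmem b).2 (hhigh _ hb)⟩
  rintro rfl
  exact h₁ ((hmem b₁).1 (hlow _ (by rw [v.map_zero]; exact (val_ne_top hb₁).lt_top)))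

/-- Some point of `S` is further away from `0` than all the points of `T`. -/
def ReachesBelow (v : AddValuation K (WithTop Γ)) (S T : K → Prop) : Prop :=
  ∃ z, S z ∧ ∀ z', T z' → v z < v z'

theorem ReachesBelow.trans {S T U : K → Prop} (h : ReachesBelow v S T)
    (h' : ReachesBelow v T U) : ReachesBelow v S U := by
  obtain ⟨z, hz, hzT⟩ := h
  obtain ⟨y, hy, hyU⟩ := h'
  exact ⟨z, hz, fun x hx => (hzT y hy).trans (hyU x hx)⟩

theorem ReachesBelow.irrefl (S : K → Prop) : ¬ ReachesBelow v S S :=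
  fun ⟨z, hz, h⟩ => (h z hz).false

theorem ReachesBelow.total [UniformlyTame L v] {S T : K → Prop} (hS : DefinablePred L K S)
    (hne : ∃ z, S z) (hdisj : ∀ z z', S z → T z' → v z ≠ v z') :
    ReachesBelow v S T ∨ ReachesBelow v T S := by
  by_contra! hno
  simp only [ReachesBelow, not_exists, not_and, not_forall, not_lt] at hno
  obtain ⟨l, hl⟩ := hS.exists_tame (v := v)
  obtain ⟨_, ⟨x, hx, rfl⟩, _, ⟨y, hy, rfl⟩, hyx, hcrit⟩ := exists_pair_avoiding
    (criticalValues v l) (V := v '' {z | S z}) (W := v '' {z | T z})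
    (hne.elim fun z hz => ⟨v z, z, hz, rfl⟩)
    (Set.forall_mem_image.2 fun x hx => by
      obtain ⟨y, hy, hyx⟩ := hno.1 x hx
      exact ⟨v y, ⟨y, hy, rfl⟩, hyx.lt_of_ne (hdisj x y hx hy).symm⟩)
    (Set.forall_mem_image.2 fun y hy => by
      obtain ⟨x, hx, hxy⟩ := hno.2 y hy
      exact ⟨v x, ⟨x, hx, rfl⟩, hxy.lt_of_ne (hdisj x y hx hy)⟩)
  exact hdisj y y ((hl.mem_iff_of_criticalValues hyx.le hcrit).2 hx) hy rfl

variable [UniformlyTame L v] [DefinableField L K]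

/-- Otherwise the residue classes that occur would be strictly ordered by how far out their
fibers reach, and a class in the middle of this order would split the residue field into two
large definable parts. -/
theorem finite_residues_of_val_invariant {U : K → Prop} {Q : K → K} (hU : DefinablePred L K U)
    (hQ : DefinableFunction L K Q) (hint : ∀ z, U z → 0 ≤ v (Q z))
    (hinv : ∀ z z', U z → v z = v z' → U z' ∧ 0 < v (Q z - Q z')) :
    ∃ F : List K, ∀ z, U z → ∃ c ∈ F, 0 < v (Q z - c) := by
  classical
  by_contra! hcon
  let fiber : K → K → Prop := fun a z => U z ∧ 0 < v (Q z - a)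
  have hfiber : DefinablePred L K fun q : K × K => fiber q.1 q.2 :=
    (hU.comp (by fun_prop)).and (.val_pos (by fun_prop))
  obtain ⟨N, hN⟩ := DefinablePred.exists_card_le_or_card_le (v := v)
    (P := fun a b => ReachesBelow v (fiber a) (fiber b)) (.ex (Y := K) (.and
      (.comp₂ hfiber (by fun_prop) (by fun_prop)) (.all (Y := K) (.imp
        (.comp₂ hfiber (by fun_prop) (by fun_prop)) (.val_lt (by fun_prop) (by fun_prop))))))
  obtain ⟨a, hne, haa⟩ := exists_distinct_residues (v := v) (A := fun a => ∃ z, fiber a z)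
    (fun F => by
      obtain ⟨z, hz, hF⟩ := hcon F
      exact ⟨Q z, ⟨z, hz, by simp⟩, hF⟩) (2 * N + 3)
  have hdisj : ∀ i j, i ≠ j → ∀ z z', fiber (a i) z → fiber (a j) z' → v z ≠ v z' :=
    fun i j hij z z' hz hz' h => (haa hij).not_gt <| by
      refine lt_val_sub_trans (y := Q z) ?_ (lt_val_sub_trans (hinv z z' hz.1 h).2 hz'.2)
      rw [v.map_sub_swap]
      exact hz.2
  have : IsStrictTotalOrder (Fin (2 * N + 3))
      fun i j => ReachesBelow v (fiber (a i)) (fiber (a j)) :=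
    { irrefl := fun _ => ReachesBelow.irrefl _
      trans := fun _ _ _ => ReachesBelow.trans
      trichotomous := fun i j hij hji => by_contra fun hne' => (ReachesBelow.total (L := L)
        (hfiber.comp₂ (.const (a i)) .id) (hne i) (hdisj i j hne')).elim hij hji }
  obtain ⟨i, hi⟩ := exists_card_filter_eq
    (fun i j => ReachesBelow v (fiber (a i)) (fiber (a j))) (k := N + 1) (by simp; omega)
  have hanneg : ∀ j, 0 ≤ v (a j) := fun j => by
    obtain ⟨z, hz, hz'⟩ := hne j
    simpa using v.map_le_sub (hint z hz) hz'.le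
  have hcard := hN (a i) a _ hanneg haa fun j =>
    Finset.mem_filter_univ (p := fun j => ReachesBelow v (fiber (a i)) (fiber (a j))) j
  rw [Finset.card_compl, hi, Fintype.card_fin] at hcard
  omega

end ReachesBelow

/-! ### Eventual constancy at infinity -/

section Constancy

/-- An equivalence relation on a valued field whose classes are balls, possibly reduced to a
point. -/
structure IsBallEquivalence {K : Type uK} [Field K] {Γ : Type uG} [AddCommGroup Γ]
    [LinearOrder Γ] [IsOrderedAddMonoid Γ] (v : AddValuation K (WithTop Γ))
    (E : K → K → Prop) : Prop extends Equivalence E where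
  of_le : ∀ {c x x'}, E x c → v (x - c) ≤ v (x' - c) → E x' c

variable {K : Type uK} [Field K] {Γ : Type uG} [AddCommGroup Γ] [LinearOrder Γ]
  [IsOrderedAddMonoid Γ] {v : AddValuation K (WithTop Γ)}

theorem IsBallEquivalence.val_sub_lt {E : K → K → Prop} (hE : IsBallEquivalence v E) {x y c : K}
    (h : E y x) (hc : ¬ E x c) : v (x - c) < v (y - x) := by
  by_contra! hle
  refine hc (hE.symm (hE.of_le h ?_))
  rwa [v.map_sub_swap c]

theorem isBallEquivalence_le_val_sub (γ : WithTop Γ) :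
    IsBallEquivalence v fun x y => γ ≤ v (x - y) where
  refl := by simp
  symm h := by rwa [v.map_sub_swap]
  trans := le_val_sub_trans
  of_le := le_trans

theorem val_add_mul_sub_eq {a c c' d : K} (hd : d ≠ 0) (ha : v a = 0)
    (hac : v (a - (c' - c) / d) ≤ 0) (hle : v (c + d - c') ≤ v d) :
    v (c + a * d - c') = v (c + d - c') := by
  have h₁ : c + a * d - c' = d * (a - (c' - c) / d) := by field_simp; ring
  have h₂ : c + d - c' = d * (1 - (c' - c) / d) := by field_simp; ring
  have hle' : v (1 - (c' - c) / d) ≤ 0 := by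
    rwa [← v.map_one, ← val_mul_le_val_mul_iff hd, mul_one, ← h₂]
  rw [h₁, h₂, val_mul_eq_val_mul_iff hd]
  rcases le_or_gt 0 (v ((c' - c) / d)) with h | h
  · rw [le_antisymm hac (v.map_le_sub ha.ge h), le_antisymm hle' (v.map_le_sub v.map_one.ge h)]
  · rw [v.map_sub_eq_of_lt_right (h.trans_le ha.ge),
      v.map_sub_eq_of_lt_right (h.trans_le v.map_one.ge)]

variable {L : FirstOrder.Language.{uF, uR}} [L.Structure K] [UniformlyTame L v]

theorem exists_uniform_of_eventually [IsAlgClosed K] {P : K → K → Prop}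
    (hP : DefinablePred L K fun q : K × K => P q.1 q.2)
    (h : ∀ c, v c = 0 → ∀ᶠ z in infFilter v, P c z) :
    ∃ g ≠ 0, ∃ F : List K, ∀ c, 0 ≤ v c → (∀ x ∈ F, v (c - x) ≤ 0) → ∀ z, v z < v g → P c z := by
  obtain ⟨N, hN⟩ := DefinablePred.generic_or_generic_not (v := v)
    (P := fun g c => ∀ z, v z < v g → P c z) (.all (Y := K) (.imp
      (.val_lt (by fun_prop) (by fun_prop)) (hP.comp₂ (by fun_prop) (by fun_prop))))
  obtain ⟨a, ha, haa⟩ := exists_distinct_residues (v := v) (exists_generic v) (N + 1)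
  obtain ⟨g, hg, hga⟩ := (eventually_infFilter_iff (UniformlyTame.surjective L)).1
    (Filter.eventually_all.2 fun i => h (a i) (ha i))
  obtain ⟨F, hFN, hF⟩ := hN g
  refine ⟨g, hg, F, hF.resolve_right fun hF => ?_⟩
  obtain ⟨i, -, hi⟩ := exists_residue_avoiding haa (F := F) (s := Finset.univ) (by simp; omega)
  exact hF _ (ha i).ge hi fun z hz => hga z hz i

theorem eventually_residue_const [IsAlgClosed K] [Nontrivial Γ] {R : K → K → Prop}
    (hR : DefinablePred L K fun q : K × K => R q.1 q.2)
    (hex : ∀ᶠ z in infFilter v, ∃ a, 0 ≤ v a ∧ R z a)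
    (hcl : ∀ z a a', R z a → 0 < v (a - a') → R z a') :
    ∃ a, 0 ≤ v a ∧ ∀ᶠ z in infFilter v, R z a := by
  by_contra! hcon
  have hnot : ∀ a, 0 ≤ v a → ∀ᶠ z in infFilter v, ¬ R z a := fun a ha =>
    (hR.comp₂ .id (.const a)).not.eventually_of_frequently (hcon a ha)
  obtain ⟨g, -, F, hF⟩ := exists_uniform_of_eventually (L := L) (v := v)
    (P := fun a z => ¬ R z a) (hR.comp₂ (by fun_prop) (by fun_prop)).not
    fun a ha => hnot a ha.ge
  have hnotF : ∀ᶠ z in infFilter v, ∀ c ∈ F, 0 ≤ v c → ¬ R z c :=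
    (Filter.eventually_all_finite (List.finite_toSet F)).2 fun c _ =>
      Filter.eventually_imp_distrib_left.2 (hnot c)
  have := infFilter_neBot (v := v) (UniformlyTame.surjective L)
  obtain ⟨z, ⟨a, ha, hRa⟩, hzg, hzF⟩ := (hex.and ((eventually_val_lt g).and hnotF)).exists
  refine hF a ha (fun c hc => ?_) z hzg hRa
  by_contra! hac
  refine hzF c hc ?_ (hcl z a c hRa hac)
  simpa using v.map_le_sub ha hac.le

variable [DefinableField L K]

theorem exists_eventually_val_sub_pos [IsAlgClosed K] [Nontrivial Γ] {u : K → K}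
    (hu : DefinableFunction L K u) (h : ∀ᶠ z in infFilter v, 0 ≤ v (u z)) :
    ∃ a, ∀ᶠ z in infFilter v, 0 < v (u z - a) := by
  obtain ⟨a, -, ha⟩ := eventually_residue_const (L := L) (v := v)
    (R := fun z a => 0 < v (u z - a)) (.val_pos (by fun_prop))
    (h.mono fun z hz => ⟨u z, hz, by simp⟩) fun z a a' => lt_val_sub_trans
  exact ⟨a, ha⟩

theorem exists_val_invariant_of_unit_invariant [IsAlgClosed K] {E : K → K → Prop}
    (hE : DefinablePred L K fun q : K × K => E q.1 q.2)
    (htrans : ∀ {x y z}, E x y → E y z → E x z) {u : K → K} (hu : DefinableFunction L K u)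
    (h : ∀ c, v c = 0 → ∀ᶠ z in infFilter v, E (u (c * z)) (u z)) :
    ∃ g ≠ 0, ∀ z z', v z < v g → v z = v z' → E (u z') (u z) := by
  obtain ⟨g, hg, F, hF⟩ := exists_uniform_of_eventually (L := L)
    (P := fun c z => E (u (c * z)) (u z)) (hE.comp₂ (by fun_prop) (by fun_prop)) h
  refine ⟨g, hg, fun z z' hz hzz' => ?_⟩
  have hz0 := ne_zero_of_val_lt hz
  obtain ⟨b, c, hbc, hb, hc, hbF, hcF⟩ := exists_generic_mul F (c := z' / z)
    ((val_div_eq_zero_iff hz0).2 hzz'.symm)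
  have hz' : z' = b * (c * z) := by rw [← mul_assoc, ← hbc, div_mul_cancel₀ _ hz0]
  rw [hz']
  exact htrans (hF b hb.ge hbF (c * z) (by rwa [v.map_mul, hc, zero_add]))
    (hF c hc.ge hcF z hz)

variable {E : K → K → Prop} {u : K → K} {g : K}

theorem finite_residues_of_not_equiv (hE : DefinablePred L K fun q : K × K => E q.1 q.2)
    (hball : IsBallEquivalence v E) (hu : DefinableFunction L K u)
    (h : ∀ z z', v z < v g → v z = v z' → E (u z') (u z)) (c : K) {d : K} (hd : d ≠ 0) :
    ∃ F : List K, ∀ z, v z < v g → v d ≤ v (u z - c) → ¬ E (u z) c →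
      ∃ b ∈ F, 0 < v ((u z - c) / d - b) := by
  obtain ⟨F, hF⟩ := finite_residues_of_val_invariant (L := L) (v := v)
    (U := fun z => v z < v g ∧ v d ≤ v (u z - c) ∧ ¬ E (u z) c) (Q := fun z => (u z - c) / d)
    (.and (.val_lt (by fun_prop) (by fun_prop)) (.and (.val_le (by fun_prop) (by fun_prop))
      (.not (.comp₂ hE (by fun_prop) (by fun_prop))))) (by fun_prop)
    (fun z hz => (val_div_nonneg_iff hd).2 hz.2.1) (by
      rintro z z' ⟨hzg, hzd, hzE⟩ hzz'
      have hEz := h z z' hzg hzz'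
      have hlt := hzd.trans_lt (hball.val_sub_lt hEz hzE)
      refine ⟨⟨hzz' ▸ hzg, le_val_sub_trans hlt.le hzd, fun hz'E =>
        hzE (hball.trans (hball.symm hEz) hz'E)⟩, ?_⟩
      rw [← sub_div, sub_sub_sub_cancel_right, val_div_pos_iff hd, v.map_sub_swap]
      exact hlt)
  exact ⟨F, fun z hz hzd hzE => hF z ⟨hz, hzd, hzE⟩⟩

/-- If a value `y` were equivalent to no centre and `c` were the centre closest to `y`, then all
the points `c + a * (y - c)` with `a` generic would be equivalent to values, contradicting the
finiteness of the residues. -/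
theorem exists_list_cover_of_val_invariant [IsAlgClosed K]
    (hE : DefinablePred L K fun q : K × K => E q.1 q.2) (hball : IsBallEquivalence v E)
    (hu : DefinableFunction L K u) (h : ∀ z z', v z < v g → v z = v z' → E (u z') (u z)) :
    ∃ C : List K, ∀ z, v z < v g → ∃ c ∈ C, E (u z) c := by
  have himage : DefinablePred L K fun y => ∃ z, v z < v g ∧ E (u z) y :=
    .ex (Y := K) (.and (.val_lt (by fun_prop) (by fun_prop))
      (.comp₂ hE (by fun_prop) (by fun_prop)))
  obtain ⟨l, hl⟩ := himage.exists_tame (v := v)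
  refine ⟨0 :: l.map Prod.fst, fun z₀ hz₀ => ?_⟩
  by_contra! hnotC
  obtain ⟨c, hcC, hcmax⟩ := Set.exists_max_image {c | c ∈ 0 :: l.map Prod.fst}
    (fun c => v (u z₀ - c)) (List.finite_toSet _) ⟨0, List.mem_cons_self⟩
  obtain ⟨d, hyd⟩ : ∃ d, u z₀ = c + d := ⟨u z₀ - c, by ring⟩
  have hd : d ≠ 0 := by
    rintro rfl
    exact hnotC c hcC (by simpa only [hyd, add_zero] using hball.refl c)
  obtain ⟨F, hF⟩ := finite_residues_of_not_equiv hE hball hu h c hd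
  obtain ⟨a, ha, haF⟩ := exists_generic v (F ++ (0 :: l.map Prod.fst).map fun c' => (c' - c) / d)
  have hval : ∀ c' ∈ 0 :: l.map Prod.fst, v (c + a * d - c') = v (u z₀ - c') := by
    intro c' hc'
    rw [hyd]
    refine val_add_mul_sub_eq hd ha (haF _ (List.mem_append_right _ (List.mem_map_of_mem hc'))) ?_
    simpa only [hyd, add_sub_cancel_left] using hcmax c' hc'
  obtain ⟨z, hz, hzE⟩ : ∃ z, v z < v g ∧ E (u z) (c + a * d) :=
    (hl.mem_iff_of_forall_eq fun q hq =>
      hval q.1 (List.mem_cons_of_mem _ (List.mem_map_of_mem hq))).2 ⟨z₀, hz₀, hball.refl _⟩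
  have hnotE : ¬ E (c + a * d) c := fun hc =>
    hnotC c hcC (hball.of_le hc (hval c hcC).le)
  have hvd : v (c + a * d - c) = v d := by rw [hval c hcC, hyd, add_sub_cancel_left]
  have hclose : v d < v (u z - (c + a * d)) := hvd ▸ hball.val_sub_lt hzE hnotE
  obtain ⟨b, hbF, hb⟩ := hF z hz (le_val_sub_trans hclose.le hvd.ge)
    fun hc => hnotE (hball.trans (hball.symm hzE) hc)
  refine (haF b (List.mem_append_left _ hbF)).not_gt (lt_val_sub_trans ?_ hb)
  rw [v.map_sub_swap, show (u z - c) / d - a = (u z - (c + a * d)) / d by field_simp; ring]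
  exact (val_div_pos_iff hd).2 hclose

theorem eventually_const_of_unit_invariant [IsAlgClosed K] [Nontrivial Γ]
    (hE : DefinablePred L K fun q : K × K => E q.1 q.2) (hball : IsBallEquivalence v E)
    (hu : DefinableFunction L K u)
    (h : ∀ c, v c = 0 → ∀ᶠ z in infFilter v, E (u (c * z)) (u z)) :
    ∃ a, ∀ᶠ z in infFilter v, E (u z) a := by
  obtain ⟨g, -, hg⟩ := exists_val_invariant_of_unit_invariant hE hball.trans hu h
  obtain ⟨C, hC⟩ := exists_list_cover_of_val_invariant hE hball hu hg
  by_contra! hcon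
  have hnotC : ∀ᶠ z in infFilter v, ∀ c ∈ C, ¬ E (u z) c :=
    (Filter.eventually_all_finite (List.finite_toSet C)).2 fun c _ =>
      (hE.comp₂ hu (.const c)).not.eventually_of_frequently (hcon c)
  have := infFilter_neBot (v := v) (UniformlyTame.surjective L)
  obtain ⟨z, hz, hzg⟩ := (hnotC.and (eventually_val_lt g)).exists
  obtain ⟨c, hcC, hc⟩ := hC z hzg
  exact hz c hcC hc

end Constancy

/-! ### Leading terms -/

section LeadingTerm

variable {K : Type uK} [Field K] {Γ : Type uG} [AddCommGroup Γ] [LinearOrder Γ]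
  [IsOrderedAddMonoid Γ]

/-- Two elements have the same image in `RV`. -/
def RVEq (v : AddValuation K (WithTop Γ)) (x y : K) : Prop := x = y ∨ v y < v (x - y)

variable {v : AddValuation K (WithTop Γ)}

namespace RVEq

theorem refl (x : K) : RVEq v x x := .inl rfl

theorem val_eq {x y : K} (h : RVEq v x y) : v x = v y :=
  h.elim (fun h => h ▸ rfl) v.map_eq_of_lt_sub

theorem symm {x y : K} (h : RVEq v x y) : RVEq v y x := by
  rcases h with rfl | h
  · exact .refl x
  · exact .inr (by rwa [v.map_sub_swap, v.map_eq_of_lt_sub h])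

theorem trans {x y z : K} (h : RVEq v x y) (h' : RVEq v y z) : RVEq v x z := by
  rcases h with rfl | h
  · exact h'
  · have hyz := h'.val_eq
    rcases h' with rfl | h'
    · exact .inr h
    · exact .inr (lt_val_sub_trans (hyz ▸ h) h')

theorem isBallEquivalence : IsBallEquivalence v (RVEq v) where
  refl := refl
  symm := symm
  trans := trans
  of_le := by
    rintro c x x' (rfl | h) hle
    · rw [sub_self, v.map_zero, top_le_iff, v.top_iff, sub_eq_zero] at hle
      exact .inl hle
    · exact .inr (h.trans_le hle)

theorem ne_zero {x y : K} (h : RVEq v x y) (hx : x ≠ 0) : y ≠ 0 := by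
  rintro rfl
  exact val_ne_top (v := v) hx (by simpa using h.val_eq)

theorem val_sub_pos {x y : K} (h : RVEq v x y) (hy : v y = 0) : 0 < v (x - y) := by
  rcases h with rfl | h
  · simp
  · rwa [hy] at h

theorem of_val_sub_pos {x y : K} (h : 0 < v (x - y)) (hx : v x = 0) : RVEq v x y :=
  .symm (.inr (by rwa [hx, v.map_sub_swap]))

theorem mul_left {x y : K} (h : RVEq v x y) (c : K) : RVEq v (c * x) (c * y) := by
  by_cases hc : c = 0
  · simp [hc, RVEq.refl]
  · rcases h with rfl | h
    · exact .refl _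
    · exact .inr (by rwa [← mul_sub, val_mul_lt_val_mul_iff hc])

theorem mul {x y x' y' : K} (h : RVEq v x y) (h' : RVEq v x' y') :
    RVEq v (x * x') (y * y') := by
  have := (h.mul_left x').trans (by simpa only [mul_comm] using h'.mul_left y)
  rwa [mul_comm x x']

theorem div_div_comm {x y z w : K} (h : RVEq v (x / y) (z / w)) (hy : y ≠ 0) (hz : z ≠ 0) :
    RVEq v (x / z) (y / w) := by
  convert h.mul_left (y / z) using 1 <;> field_simp

theorem of_div_left {x y z : K} (h : RVEq v (x / y) (x / z)) (hx : x ≠ 0) (hy : y ≠ 0)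
    (hz : z ≠ 0) : RVEq v z y := by
  convert h.mul_left (y * z / x) using 1 <;> field_simp

end RVEq

variable {L : FirstOrder.Language.{uF, uR}} [L.Structure K] [UniformlyTame L v]
  [DefinableField L K]

theorem DefinablePred.rvEq {X : Type uK} [CartesianPower K X] {f g : X → K}
    (hf : DefinableFunction L K f) (hg : DefinableFunction L K g) :
    DefinablePred L K fun x => RVEq v (f x) (g x) :=
  .or (.eq (by fun_prop) (by fun_prop)) (.val_lt (by fun_prop) (by fun_prop))

variable [IsAlgClosed K] [Nontrivial Γ] {H : K → K}

theorem eventually_rvEq_const (hH : DefinableFunction L K H)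
    (h : ∀ c, v c = 0 → ∀ᶠ z in infFilter v, RVEq v (H (c * z)) (H z)) :
    ∃ a, ∀ᶠ z in infFilter v, RVEq v (H z) a :=
  eventually_const_of_unit_invariant (.rvEq (by fun_prop) (by fun_prop)) RVEq.isBallEquivalence
    hH h

theorem exists_generic_eventually_not_of_asymm {P : K → K → Prop}
    (hP : DefinablePred L K fun q : K × K => P q.1 q.2) (hasymm : ∀ x y, P x y → ¬ P y x)
    (hH : DefinableFunction L K H) :
    ∃ F : List K, ∀ c, v c = 0 → (∀ x ∈ F, v (c - x) ≤ 0) →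
      ∀ᶠ z in infFilter v, ¬ P (H z) (H (c * z)) := by
  have hev : DefinablePred L K fun q : K × K =>
      ∀ᶠ z in infFilter v, P (H z) (H (q.2 * z)) :=
    .eventually (hP.comp₂ (by fun_prop) (by fun_prop))
  obtain ⟨N, hN⟩ := hev.generic_or_generic_not (v := v)
    (P := fun _ c => ∀ᶠ z in infFilter v, P (H z) (H (c * z)))
  obtain ⟨F, -, hF | hF⟩ := hN 0
  · obtain ⟨a, b, hab, ha, hb, haF, hbF⟩ := exists_generic_mul F v.map_one
    have := infFilter_neBot (v := v) (UniformlyTame.surjective L)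
    obtain ⟨z, h₁, h₂⟩ := ((hF b hb.ge hbF).and
      (eventually_mul_left (hF a ha.ge haF) (ne_zero_of_val_eq_zero hb))).exists
    rw [← mul_assoc, ← hab, one_mul] at h₂
    exact absurd h₂ (hasymm _ _ h₁)
  · exact ⟨F, fun c hc hcF => DefinablePred.eventually_of_frequently
      (hP.comp₂ (by fun_prop) (by fun_prop)).not (Filter.not_eventually.1 (hF c hc.ge hcF))⟩

theorem eventually_val_mul_left_eq (hH : DefinableFunction L K H) {c : K} (hc : v c = 0) :
    ∀ᶠ z in infFilter v, v (H (c * z)) = v (H z) := by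
  obtain ⟨F, hF⟩ := exists_generic_eventually_not_of_asymm (v := v)
    (P := fun x y => v x < v y) (.val_lt (by fun_prop) (by fun_prop)) (fun _ _ => lt_asymm) hH
  obtain ⟨G, hG⟩ := exists_generic_eventually_not_of_asymm (v := v)
    (P := fun x y => v y < v x) (.val_lt (by fun_prop) (by fun_prop)) (fun _ _ => lt_asymm) hH
  have hgen : ∀ b, v b = 0 → (∀ x ∈ F ++ G, v (b - x) ≤ 0) →
      ∀ᶠ z in infFilter v, v (H (b * z)) = v (H z) := fun b hb hbFG => by
    rw [List.forall_mem_append] at hbFG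
    filter_upwards [hF b hb hbFG.1, hG b hb hbFG.2] with z h₁ h₂
      using le_antisymm (not_lt.1 h₁) (not_lt.1 h₂)
  obtain ⟨a, b, rfl, ha, hb, haF, hbF⟩ := exists_generic_mul (F ++ G) hc
  filter_upwards [hgen b hb hbF, eventually_mul_left (hgen a ha haF) (ne_zero_of_val_eq_zero hb)]
    with z h₁ h₂
  rw [mul_assoc, h₂, h₁]

theorem exists_eventually_rvEq_ratio_of_val_eq_zero (hH : DefinableFunction L K H)
    (hne : ∀ᶠ z in infFilter v, H z ≠ 0) {c : K} (hc : v c = 0) :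
    ∃ a, ∀ᶠ z in infFilter v, RVEq v (H (c * z) / H z) a := by
  have hratio : ∀ᶠ z in infFilter v, v (H (c * z) / H z) = 0 := by
    filter_upwards [eventually_val_mul_left_eq hH hc, hne] with z hz hz0
      using (val_div_eq_zero_iff hz0).2 hz
  obtain ⟨a, ha⟩ := exists_eventually_val_sub_pos (L := L) (u := fun z => H (c * z) / H z)
    (by fun_prop) (hratio.mono fun z hz => hz.ge)
  refine ⟨a, ?_⟩
  filter_upwards [ha, hratio] with z h₁ h₂ using .of_val_sub_pos h₁ h₂

theorem exists_eventually_rvEq_ratio (hH : DefinableFunction L K H)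
    (hne : ∀ᶠ z in infFilter v, H z ≠ 0) {c : K} (hc : c ≠ 0) :
    ∃ a, ∀ᶠ z in infFilter v, RVEq v (H (c * z) / H z) a := by
  refine eventually_rvEq_const (L := L) (H := fun z => H (c * z) / H z) (by fun_prop)
    fun b hb => ?_
  obtain ⟨a, ha⟩ := exists_eventually_rvEq_ratio_of_val_eq_zero hH hne hb
  filter_upwards [ha, eventually_mul_left ha hc, eventually_mul_left hne hc,
    eventually_mul_left hne (ne_zero_of_val_eq_zero hb)] with z h₁ h₂ h₃ h₄
  rw [mul_left_comm c b z]
  exact (h₂.trans h₁.symm).div_div_comm h₃ h₄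

end LeadingTerm

section TendsToZeroFromAbove

variable {K : Type uK} [Field K] {Γ : Type uG} [AddCommGroup Γ] [LinearOrder Γ]
  [IsOrderedAddMonoid Γ]

/-- The valuation of `H` is positive near infinity, and eventually below every positive value. -/
structure TendsToZeroFromAbove (v : AddValuation K (WithTop Γ)) (H : K → K) : Prop where
  val_pos : ∀ᶠ z in infFilter v, 0 < v (H z)
  val_le : ∀ e ≠ 0, 0 < v e → ∀ᶠ z in infFilter v, v (H z) ≤ v e

namespace TendsToZeroFromAbove

variable {v : AddValuation K (WithTop Γ)} [Nontrivial Γ] {H : K → K}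

theorem eventually_ne_zero (h : TendsToZeroFromAbove v H) (hv : Function.Surjective v) :
    ∀ᶠ z in infFilter v, H z ≠ 0 := by
  obtain ⟨γ, hγ⟩ := exists_zero_lt (α := Γ)
  obtain ⟨e, he⟩ := hv γ
  have he0 : e ≠ 0 := ne_zero_of_val_eq_coe he
  filter_upwards [h.val_le e he0 (by rw [he]; exact_mod_cast hγ)] with z hz h0
  rw [h0, v.map_zero, top_le_iff] at hz
  exact val_ne_top he0 hz

theorem val_ratio_eq_zero (h : TendsToZeroFromAbove v H) (hv : Function.Surjective v) {a c : K}
    (hc : c ≠ 0) (ha : ∀ᶠ z in infFilter v, RVEq v (H (c * z) / H z) a) : v a = 0 := by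
  have := infFilter_neBot hv
  have hne := h.eventually_ne_zero hv
  have ha0 : a ≠ 0 := by
    obtain ⟨z, h₁, h₂, h₃⟩ := (ha.and (hne.and (eventually_mul_left hne hc))).exists
    exact h₁.ne_zero (div_ne_zero h₃ h₂)
  have hva : ∀ᶠ z in infFilter v, v (H (c * z)) = v (a * H z) := by
    filter_upwards [ha, hne] with z h₁ h₂
    rw [v.map_mul, ← h₁.val_eq, ← v.map_mul, div_mul_cancel₀ _ h₂]
  refine le_antisymm ?_ ?_ <;> by_contra! hlt
  · obtain ⟨z, h₁, h₂, h₃⟩ := (hva.and (h.val_pos.and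
      (eventually_mul_left (h.val_le a ha0 hlt) hc))).exists
    exact (h₁ ▸ h₃).not_gt ((val_lt_val_mul_iff ha0).2 h₂)
  · have hinv : 0 < v a⁻¹ := by rwa [← one_div, val_div_pos_iff ha0, v.map_one]
    obtain ⟨z, h₁, h₂, h₃⟩ := (hva.and ((h.val_le a⁻¹ (inv_ne_zero ha0) hinv).and
      (eventually_mul_left h.val_pos hc))).exists
    rw [h₁, ← v.map_one, ← mul_inv_cancel₀ ha0, val_mul_lt_val_mul_iff ha0] at h₃
    exact h₃.not_ge h₂

variable {L : FirstOrder.Language.{uF, uR}} [L.Structure K] [UniformlyTame L v]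
  [DefinableField L K] [IsAlgClosed K]

theorem exists_eventually_eventually_rvEq_ratio (h : TendsToZeroFromAbove v H)
    (hH : DefinableFunction L K H) :
    ∃ a, ∀ᶠ c in infFilter v, ∀ᶠ z in infFilter v, RVEq v (H (c * z) / H z) a := by
  have hv : Function.Surjective v := UniformlyTame.surjective L
  have hratio : ∀ c ≠ 0, ∃ a, v a = 0 ∧ ∀ᶠ z in infFilter v, RVEq v (H (c * z) / H z) a :=
    fun c hc => (exists_eventually_rvEq_ratio hH (h.eventually_ne_zero hv) hc).imp
      fun a ha => ⟨h.val_ratio_eq_zero hv hc ha, ha⟩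
  obtain ⟨a, -, ha⟩ := eventually_residue_const (L := L) (v := v)
    (R := fun c a => ∀ᶠ z in infFilter v, 0 < v (H (c * z) / H z - a))
    (.eventually (.val_pos (by fun_prop)))
    (_root_.eventually_ne_zero.mono fun c hc => by
      obtain ⟨a, ha, h⟩ := hratio c hc
      exact ⟨a, ha.ge, h.mono fun z hz => hz.val_sub_pos ha⟩)
    fun c a a' h h' => h.mono fun z hz => lt_val_sub_trans hz h'
  refine ⟨a, ?_⟩
  filter_upwards [ha, _root_.eventually_ne_zero] with c hca hc
  obtain ⟨b, hb, hcb⟩ := hratio c hc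
  filter_upwards [hca, hcb] with z h₁ h₂ using .of_val_sub_pos h₁ (h₂.val_eq.trans hb)

theorem exists_eventually_rvEq (h : TendsToZeroFromAbove v H) (hH : DefinableFunction L K H) :
    ∃ b, ∀ᶠ z in infFilter v, RVEq v (H z) b := by
  have hv : Function.Surjective v := UniformlyTame.surjective L
  have := infFilter_neBot hv
  have hne := h.eventually_ne_zero hv
  obtain ⟨a, ha⟩ := h.exists_eventually_eventually_rvEq_ratio hH
  refine eventually_rvEq_const hH fun c hc => ?_
  have hc0 := ne_zero_of_val_eq_zero hc
  obtain ⟨d, hd, hcd, hd0⟩ :=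
    (ha.and ((eventually_mul_left ha hc0).and _root_.eventually_ne_zero)).exists
  filter_upwards [eventually_mul_left hd hc0, hcd, hne, eventually_mul_left hne hc0,
    eventually_mul_left hne (mul_ne_zero hc0 hd0)] with z h₁ h₂ h₃ h₄ h₅
  rw [mul_left_comm, ← mul_assoc] at h₁
  exact (h₂.trans h₁.symm).of_div_left h₅ h₃ h₄

end TendsToZeroFromAbove

theorem not_tendsToZeroFromAbove {L : FirstOrder.Language.{uF, uR}} [L.Structure K]
    {v : AddValuation K (WithTop Γ)} [UniformlyTame L v] [DefinableField L K] [IsAlgClosed K]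
    [Nontrivial Γ] {H : K → K} (hH : DefinableFunction L K H) : ¬ TendsToZeroFromAbove v H := by
  intro h
  have hv : Function.Surjective v := UniformlyTame.surjective L
  have := infFilter_neBot hv
  obtain ⟨b, hb⟩ := h.exists_eventually_rvEq hH
  obtain ⟨z₀, h₁, h₂, h₃⟩ := (hb.and ((h.eventually_ne_zero hv).and h.val_pos)).exists
  obtain ⟨e, rfl⟩ := IsAlgClosed.exists_eq_mul_self b
  have he0 : e ≠ 0 := left_ne_zero_of_mul (h₁.ne_zero h₂)
  have he : 0 < v e := by
    by_contra! hle
    rw [h₁.val_eq, v.map_mul] at h₃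
    exact (add_nonpos hle hle).not_gt h₃
  obtain ⟨z, h₄, h₅⟩ := (hb.and (h.val_le e he0 he)).exists
  exact (h₄.val_eq ▸ h₅).not_gt ((val_lt_val_mul_iff he0).2 he)

end TendsToZeroFromAbove

section Convergence

variable {L : FirstOrder.Language.{uF, uR}} {K : Type uK} [L.Structure K] [Field K]
  {Γ : Type uG} [AddCommGroup Γ] [LinearOrder Γ] [IsOrderedAddMonoid Γ]
  {v : AddValuation K (WithTop Γ)} [UniformlyTame L v] [DefinableField L K] [IsAlgClosed K]
  [Nontrivial Γ] {u : K → K} {r : K}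

theorem exists_eventually_le_val_sub_of_forall_lt (hu : DefinableFunction L K u) (hr : r ≠ 0)
    (h : ∀ b, v b < v r → ∃ a, ∀ᶠ z in infFilter v, v b ≤ v (u z - a)) :
    ∃ a, ∀ᶠ z in infFilter v, v r ≤ v (u z - a) := by
  refine eventually_const_of_unit_invariant (.val_le (by fun_prop) (by fun_prop))
    (isBallEquivalence_le_val_sub (v r)) hu fun c hc => ?_
  by_contra hnot
  have hlt : ∀ᶠ z in infFilter v, v (u (c * z) - u z) < v r :=
    (DefinablePred.eventually_of_frequently (L := L) (.not (.val_le (by fun_prop) (by fun_prop)))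
      (Filter.not_eventually.1 hnot)).mono fun z => not_le.1
  have hne : ∀ᶠ z in infFilter v, u (c * z) - u z ≠ 0 := hlt.mono fun z => ne_zero_of_val_lt
  refine not_tendsToZeroFromAbove (L := L) (v := v) (H := fun z => r / (u (c * z) - u z))
    (by fun_prop) ⟨?_, fun e he hve => ?_⟩
  · filter_upwards [hlt, hne] with z hz hz0 using (val_div_pos_iff hz0).2 hz
  · have hre : v (r / e) < v r := by
      have := (val_lt_val_mul_iff (div_ne_zero hr he)).2 hve
      rwa [div_mul_cancel₀ _ he] at this
    obtain ⟨a, ha⟩ := h _ hre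
    filter_upwards [ha, eventually_mul_left ha (ne_zero_of_val_eq_zero hc), hne] with z h₁ h₂ h₃
    rw [v.map_sub_swap] at h₁
    have h₄ := (val_mul_le_val_mul_iff he).2 (le_val_sub_trans h₂ h₁)
    rw [mul_div_cancel₀ _ he] at h₄
    rwa [← val_mul_le_val_mul_iff h₃, mul_div_cancel₀ _ h₃, mul_comm]

theorem exists_lt_val_eventually_le_val_sub (hu : DefinableFunction L K u) (hr : r ≠ 0) {a : K}
    (h : ∀ᶠ z in infFilter v, v r ≤ v (u z - a)) :
    ∃ b, v r < v b ∧ ∃ a', ∀ᶠ z in infFilter v, v b ≤ v (u z - a') := by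
  by_contra! hhigh
  obtain ⟨a', ha'⟩ := exists_eventually_val_sub_pos (L := L) (u := fun z => (u z - a) / r)
    (by fun_prop) (h.mono fun z => (val_div_nonneg_iff hr).2)
  refine not_tendsToZeroFromAbove (L := L) (v := v) (H := fun z => (u z - a) / r - a')
    (by fun_prop) ⟨ha', fun e _ hve => ?_⟩
  filter_upwards [DefinablePred.eventually_of_frequently (L := L)
    (.val_lt (by fun_prop) (by fun_prop))
    (hhigh (r * e) ((val_lt_val_mul_iff hr).2 hve) (a + r * a'))] with z hz
  rw [show u z - (a + r * a') = r * ((u z - a) / r - a') by field_simp; ring,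
    val_mul_lt_val_mul_iff hr] at hz
  exact hz.le

theorem exists_eventually_le_val_sub (hu : DefinableFunction L K u) {b₀ : K}
    (hb₀ : ∀ᶠ z in infFilter v, v b₀ ≤ v (u z)) {b : K} (hb : b ≠ 0) :
    ∃ a, ∀ᶠ z in infFilter v, v b ≤ v (u z - a) := by
  by_contra hcon
  obtain ⟨r, hr, hlow, hhigh⟩ := exists_endpoint (L := L) (v := v)
    (R := fun b => ∃ a, ∀ᶠ z in infFilter v, v b ≤ v (u z - a))
    (.ex (Y := K) (.eventually (.val_le (by fun_prop) (by fun_prop))))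
    (fun b b' hbb' ⟨a, ha⟩ => ⟨a, ha.mono fun z => hbb'.trans⟩)
    ⟨0, by simpa using hb₀⟩ hcon hb
  obtain ⟨a, ha⟩ := exists_eventually_le_val_sub_of_forall_lt hu hr hlow
  obtain ⟨b', hb', h⟩ := exists_lt_val_eventually_le_val_sub hu hr ha
  exact hhigh b' hb' h

end Convergence

/-! ### Expansions of a valued field -/

section Expansion

variable {L : FirstOrder.Language.{uF, uR}} {K : Type uK} [L.Structure K]

theorem definableFunction_funMap (f : L.Functions 2) :
    DefinableFunction L K fun q : K × K => Language.Structure.funMap f ![q.1, q.2] := fun _ => by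
  have := (f.apply₂ (Language.Term.var (Sum.inl ()) : L.Term (Unit ⊕ Unit))
    (Language.Term.var (Sum.inr ()))).definableFun_realize (M := K)
  simp only [Language.Term.realize_functions_apply₂] at this
  exact .of_empty this

theorem definablePred_relMap (R : L.Relations 2) :
    DefinablePred L K fun q : K × K => Language.Structure.RelMap R ![q.1, q.2] := by
  refine Set.Definable.mono (A := ∅) (Set.empty_definable_iff.2 ⟨R.formula₂
    (Language.Term.var (Sum.inl ()) : L.Term (Unit ⊕ Unit)) (Language.Term.var (Sum.inr ())), ?_⟩)
    (empty_subset _)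
  ext z
  simp only [Set.mem_ofPred_eq, Language.Formula.realize_rel₂]
  exact Iff.rfl

namespace IsValuedFieldExpansion

variable [Field K] {Γ : Type uG} [AddCommGroup Γ] [LinearOrder Γ]
  [IsOrderedAddMonoid Γ] {v : AddValuation K (WithTop Γ)} {φ : FirstOrder.Language.LHom Ldiv L}
  (hφ : IsValuedFieldExpansion v φ)
include hφ

theorem funMap_eq {n : ℕ} (f : DivFunc n) (x : Fin n → K) :
    Language.Structure.funMap (φ.onFunction f) x = (divStructure v).funMap f x :=
  let _ := divStructure v
  Language.LHom.IsExpansionOn.map_onFunction (self := hφ) f x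

theorem divSub_eq (x y : K) : divSub φ K x y = x - y :=
  hφ.funMap_eq DivFunc.sub ![x, y]

theorem divRel_iff (x y : K) : divRel φ K x y ↔ v x ≤ v y :=
  let _ := divStructure v
  iff_of_eq (Language.LHom.IsExpansionOn.map_onRelation (self := hφ) DivRel.div ![x, y])

theorem definableField : DefinableField L K where
  sub := by
    convert! definableFunction_funMap (K := K) (φ.onFunction DivFunc.sub) using 2 with q
    exact (hφ.funMap_eq DivFunc.sub ![q.1, q.2]).symm
  mul := by
    convert! definableFunction_funMap (K := K) (φ.onFunction DivFunc.mul) using 2 with q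
    exact (hφ.funMap_eq DivFunc.mul ![q.1, q.2]).symm

theorem uniformlyTame (hv : Function.Surjective v) (hC : IsCMinimal φ K) : UniformlyTame L v where
  surjective := hv
  le := (definablePred_relMap (K := K) (φ.onRelation DivRel.div)).congr fun q =>
    (hφ.divRel_iff q.1 q.2).symm
  tame hP := by
    obtain ⟨N, hN⟩ := hC.exists_uniform_modelTame φ hP
    refine ⟨N, fun t => ?_⟩
    obtain ⟨l, hlN, hl⟩ := hN t
    refine ⟨l, hlN, fun x y hxy => hl x y fun q hq => ?_⟩
    simp only [SamePosition, hφ.divSub_eq, hφ.divRel_iff]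
    exact hxy q hq

end IsValuedFieldExpansion

end Expansion

/-! ### Fractional powers and `RV` -/

section FracPow

variable {M : Type*} [CommGroupWithZero M] {p : ℕ} (hp : Function.Bijective fun x : M => x ^ p)

include hp in
theorem pow_pow_injective (m : ℕ) : Function.Injective fun x : M => x ^ p ^ m := by
  simpa only [pow_iterate] using hp.injective.iterate m

theorem fracPow_pow (x : M) (n : ℤ) (m : ℕ) : fracPow p hp x n m ^ p ^ m = x ^ n := by
  have h (m : ℕ) (y : M) :
      ((MulEquiv.ofBijective (powMonoidHom p : M →* M) hp : MulAut M) ^ m) y = y ^ p ^ m := by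
    induction m with
    | zero => simp
    | succ m ih =>
      rw [pow_succ', MulAut.mul_apply, ih, pow_succ, pow_mul]
      rfl
  rw [fracPow, ← h, zpow_neg, zpow_natCast, MulAut.apply_inv_self]

end FracPow

section RV

variable {K : Type uK} [Field K] {Γ : Type uG} [AddCommGroup Γ] [LinearOrder Γ]
  [IsOrderedAddMonoid Γ] (v : AddValuation K (WithTop Γ))

theorem rv_coe (x : Kˣ) : rv v x = (RVStar.mk v x : RV v) := by
  simp [rv]

/-- The map `rv` as a homomorphism of monoids with zero. -/
noncomputable def rvHom : K →*₀ RV v where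
  toFun := rv v
  map_zero' := by simp [rv]
  map_one' := by
    have := rv_coe v 1
    rwa [map_one, Units.val_one] at this
  map_mul' x y := by
    by_cases hx : x = 0
    · simp [rv, hx]
    · by_cases hy : y = 0
      · simp [rv, hy]
      · have := rv_coe v (Units.mk0 x hx * Units.mk0 y hy)
        rwa [map_mul, WithZero.coe_mul, ← rv_coe, ← rv_coe] at this

theorem rvHom_apply (x : K) : rvHom v x = rv v x := rfl

variable {v}

theorem rv_eq_one_iff {x : K} : rv v x = 1 ↔ 0 < v (x - 1) := by
  by_cases hx : x = 0
  · simp [hx, rv, v.map_neg]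
  · rw [← Units.val_mk0 hx, rv_coe, ← WithZero.coe_one, WithZero.coe_inj, RVStar.mk_eq_one_iff]

theorem rv_eq_iff {x y : K} : rv v x = rv v y ↔ RVEq v x y := by
  rw [← rvHom_apply, ← rvHom_apply]
  by_cases hy : y = 0
  · rw [hy, map_zero, map_eq_zero]
    exact ⟨.inl, fun h => h.elim id fun h => by simp at h⟩
  · rw [← div_eq_one_iff_eq ((map_ne_zero _).2 hy), ← map_div₀, rvHom_apply, rv_eq_one_iff,
      ← div_self hy, ← sub_div, val_div_pos_iff hy]
    exact ⟨.inr, fun h => h.elim (fun h => by simpa [h] using (val_ne_top hy).lt_top) id⟩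

end RV

/-! ### Slopes and leading coefficients at infinity -/

section Slope

variable {K : Type uK} [Field K] {Γ : Type uG} [AddCommGroup Γ] [LinearOrder Γ]
  [IsOrderedAddMonoid Γ] {v : AddValuation K (WithTop Γ)}

theorem val_eq_zero_of_val_pow_eq_zero {x : K} {n : ℕ} (hn : n ≠ 0) (h : v (x ^ n) = 0) :
    v x = 0 := by
  rw [v.map_pow] at h
  rcases lt_trichotomy (v x) 0 with h' | h' | h'
  · exact absurd h (nsmul_neg h' hn).ne
  · exact h'
  · exact absurd h (nsmul_pos h' hn).ne'

theorem val_eq_zero_of_val_zpow_eq_zero {x : K} {n : ℤ} (hn : n ≠ 0) (h : v (x ^ n) = 0) :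
    v x = 0 := by
  obtain ⟨m, rfl | rfl⟩ := n.eq_nat_or_neg
  · exact val_eq_zero_of_val_pow_eq_zero (by simpa using hn) (by rwa [zpow_natCast] at h)
  · have hinv : v x⁻¹ = 0 :=
      val_eq_zero_of_val_pow_eq_zero (n := m) (by simpa using hn) (by simpa using h)
    rwa [← one_div, val_div_eq_zero_iff (by simpa using ne_zero_of_val_eq_zero hinv), v.map_one,
      eq_comm] at hinv

theorem val_eq_of_val_pow_eq {x y : K} {n : ℕ} (hn : n ≠ 0) (h : v (x ^ n) = v (y ^ n)) :
    v x = v y := by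
  by_cases hy : y = 0
  · rw [hy, zero_pow hn, v.map_zero, v.top_iff] at h
    rw [hy, eq_zero_of_pow_eq_zero h]
  · rw [← val_div_eq_zero_iff hy]
    refine val_eq_zero_of_val_pow_eq_zero hn ?_
    rw [div_pow, val_div_eq_zero_iff (pow_ne_zero n hy), h]

theorem val_zpow_eq_coe {x : K} {γ : Γ} (h : v x = γ) (n : ℤ) :
    v (x ^ n) = ((n • γ : Γ) : WithTop Γ) := by
  cases n with
  | ofNat n => simp [v.map_pow, h]
  | negSucc n =>
    rw [zpow_negSucc, v.map_inv, v.map_pow, h, negSucc_zsmul, ← WithTop.coe_nsmul]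
    rfl

theorem RVEq.pow {x y : K} (h : RVEq v x y) (n : ℕ) : RVEq v (x ^ n) (y ^ n) := by
  induction n with
  | zero => simpa only [pow_zero] using RVEq.refl 1
  | succ n ih => simpa only [pow_succ] using ih.mul h

theorem RVEq.of_pow [IsAlgClosed K] {p : ℕ} [ExpChar K p] {m : ℕ} {x y : K}
    (h : RVEq v (x ^ p ^ m) (y ^ p ^ m)) : RVEq v x y := by
  rw [← rv_eq_iff, ← rvHom_apply, ← rvHom_apply] at h ⊢
  exact pow_pow_injective (pow_bijective_rv v p) m (by simpa only [map_pow] using h)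

theorem eventually_pow {P : K → Prop} (hP : ∀ᶠ z in infFilter v, P z) {n : ℕ} (hn : n ≠ 0) :
    ∀ᶠ z in infFilter v, P (z ^ n) := by
  obtain ⟨γ, hγ⟩ := eventually_infFilter.1 hP
  filter_upwards [eventually_val_lt_coe γ, eventually_val_lt_coe 0] with z h₁ h₂
  refine hγ _ (lt_of_le_of_lt ?_ h₁)
  obtain ⟨m, rfl⟩ := Nat.exists_eq_succ_of_ne_zero hn
  rw [pow_succ, v.map_mul, v.map_pow]
  exact add_le_of_nonpos_left (nsmul_nonpos h₂.le m)

theorem eq_zero_of_eventually_val_zpow_eq [Nontrivial Γ] (hv : Function.Surjective v) {n : ℤ}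
    {d : K} (h : ∀ᶠ x in infFilter v, v (x ^ n) = v d) : n = 0 := by
  have := infFilter_neBot hv
  obtain ⟨γ, hγ⟩ := exists_ne (0 : Γ)
  obtain ⟨c, hc⟩ := hv γ
  obtain ⟨x, h₁, h₂, hx⟩ := (h.and ((eventually_mul_left h (ne_zero_of_val_eq_coe hc)).and
    eventually_ne_zero)).exists
  rw [← h₁, mul_zpow, ← val_div_eq_zero_iff (zpow_ne_zero n hx),
    mul_div_cancel_right₀ _ (zpow_ne_zero n hx)] at h₂
  by_contra hn
  have := hc.symm.trans (val_eq_zero_of_val_zpow_eq_zero hn h₂)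
  exact hγ (by exact_mod_cast this)

/-- `v (f x)` equals `r • v x` up to an additive constant, for all `x` near infinity; the equation
is written with denominators cleared. -/
def HasSlope (v : AddValuation K (WithTop Γ)) (f : K → K) (r : ℚ) : Prop :=
  ∃ d ≠ 0, ∀ᶠ x in infFilter v, v (f x ^ r.den) = v (x ^ r.num * d)

/-- `rv (f x)` equals `rv x ^ r * rv d` for all `x` near infinity, with both sides raised to the
denominator of `r`. -/
def IsLeadingCoefficient (v : AddValuation K (WithTop Γ)) (f : K → K) (r : ℚ) (d : K) : Prop :=
  ∀ᶠ x in infFilter v, RVEq v (f x ^ r.den / x ^ r.num) (d ^ r.den)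

theorem hasSlope_of_eventually_linear (hv : Function.Surjective v) {f : K → K} {h : Γ → Γ} {r : ℚ}
    {δ α : Γ} (hf : ∀ᶠ x in infFilter v, ∃ γ : Γ, v x = γ ∧ v (f x) = h γ)
    (hh : ∀ γ < δ, r.den • (h γ - α) = r.num • γ) : HasSlope v f r := by
  obtain ⟨d, hd⟩ := hv ((r.den • α : Γ) : WithTop Γ)
  refine ⟨d, ne_zero_of_val_eq_coe hd, ?_⟩
  filter_upwards [hf, eventually_val_lt_coe δ] with x ⟨γ, hxγ, hfγ⟩ hxδ
  have hγ := hh γ (by rwa [hxγ, WithTop.coe_lt_coe] at hxδ)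
  rw [smul_sub, sub_eq_iff_eq_add] at hγ
  rw [v.map_pow, hfγ, v.map_mul, val_zpow_eq_coe hxγ, hd, ← WithTop.coe_nsmul, hγ, WithTop.coe_add]

namespace HasSlope

variable {f : K → K} {r : ℚ}

theorem congr (h : HasSlope v f r) {g : K → K} (hfg : ∀ᶠ x in infFilter v, g x = f x) :
    HasSlope v g r := by
  obtain ⟨d, hd, h⟩ := h
  refine ⟨d, hd, ?_⟩
  filter_upwards [h, hfg] with x h₁ h₂
  rw [h₂, h₁]

variable [Nontrivial Γ]

theorem unique (hv : Function.Surjective v) {r' : ℚ} (h : HasSlope v f r)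
    (h' : HasSlope v f r') : r = r' := by
  obtain ⟨d, hd, h⟩ := h
  obtain ⟨d', hd', h'⟩ := h'
  refine Rat.eq_iff_mul_eq_mul.2 (sub_eq_zero.1 (eq_zero_of_eventually_val_zpow_eq hv
    (d := d' ^ r.den / d ^ r'.den) ?_))
  filter_upwards [h, h', eventually_ne_zero] with x h₁ h₂ hx
  have hpow : v ((x ^ r.num * d) ^ r'.den) = v ((x ^ r'.num * d') ^ r.den) := by
    rw [v.map_pow, ← h₁, ← v.map_pow, ← pow_mul, mul_comm, pow_mul, v.map_pow, h₂, v.map_pow]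
  have hdpow := pow_ne_zero r'.den hd
  have hxpow := zpow_ne_zero (r'.num * r.den) hx
  rw [← val_mul_eq_val_mul_iff (mul_ne_zero hxpow hdpow)]
  convert hpow using 2
  · rw [mul_pow, ← zpow_natCast (x ^ r.num), ← zpow_mul, zpow_sub₀ hx]
    field_simp
  · rw [mul_pow, ← zpow_natCast (x ^ r'.num), ← zpow_mul]
    field_simp

end HasSlope

end Slope

section LeadingCoefficient

variable {L : FirstOrder.Language.{uF, uR}} {K : Type uK} [L.Structure K] [Field K]
  {Γ : Type uG} [AddCommGroup Γ] [LinearOrder Γ] [IsOrderedAddMonoid Γ]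
  {v : AddValuation K (WithTop Γ)} [UniformlyTame L v] [DefinableField L K]

theorem DefinablePred.hasSlope {X : Type uK} [CartesianPower K X] {F : X → K → K}
    (hF : DefinableFunction L K fun q : X × K => F q.1 q.2) (r : ℚ) :
    DefinablePred L K fun t => HasSlope v (F t) r := by
  have : DefinableFunction L K fun q : (X × K) × K => F q.1.1 q.2 :=
    hF.comp (g := fun q : X × K => F q.1 q.2) (f := fun q : (X × K) × K => (q.1.1, q.2))
      (by fun_prop)
  exact .ex (Y := K) (.and (.not (.eq (by fun_prop) (by fun_prop)))
    (.eventually (.val_eq (by fun_prop) (by fun_prop))))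

theorem DefinablePred.isLeadingCoefficient {X : Type uK} [CartesianPower K X] {F : X → K → K}
    (hF : DefinableFunction L K fun q : X × K => F q.1 q.2) (r : ℚ) {d : X → K}
    (hd : DefinableFunction L K d) :
    DefinablePred L K fun t => IsLeadingCoefficient v (F t) r (d t) :=
  .eventually (.rvEq (by fun_prop) (by fun_prop))

variable [IsAlgClosed K] [Nontrivial Γ]

theorem eq_one_of_rotate_eq_mul {y : K → K} (hy : DefinableFunction L K y) {d ζ ρ : K}
    (hd : d ≠ 0) (hζ : ζ ≠ 0) (hyd : ∀ᶠ z in infFilter v, v (y z) = v d)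
    (hrot : ∀ z, y (ζ * z) = y z * ρ) : ρ = 1 := by
  by_contra hρ
  have hv : Function.Surjective v := UniformlyTame.surjective L
  have := infFilter_neBot hv
  obtain ⟨γ, hγ⟩ := exists_zero_lt (α := Γ)
  obtain ⟨e, he⟩ := hv γ
  have hne : d * (ρ - 1) ≠ 0 := mul_ne_zero hd (sub_ne_zero.2 hρ)
  obtain ⟨c, hc⟩ := exists_eventually_le_val_sub hy (hyd.mono fun z hz => hz.ge)
    (mul_ne_zero hne (ne_zero_of_val_eq_coe he))
  obtain ⟨z, h₁, h₂, h₃⟩ := (hc.and ((eventually_mul_left hc hζ).and hyd)).exists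
  have hclose := le_val_sub_trans h₂ ((v.map_sub_swap _ _).symm ▸ h₁)
  rw [hrot, ← mul_sub_one, v.map_mul (y z), h₃, ← v.map_mul] at hclose
  refine hclose.not_gt ((val_lt_val_mul_iff hne).2 ?_)
  rw [he]
  exact_mod_cast hγ

namespace HasSlope

variable {f : K → K} {r : ℚ} (h : HasSlope v f r) (hf : DefinableFunction L K f)
include h hf

/-- For a root of unity `ζ` of order `q`, replacing `z` by `ζ * z` would multiply
`f (z ^ q) ^ (r.den / q) / z ^ r.num`, whose valuation is constant, by the constant
`ζ ^ (-r.num) ≠ 1`. -/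
theorem not_dvd_den {q : ℕ} (hq : q.Prime) (hqK : (q : K) ≠ 0) : ¬ q ∣ r.den := by
  rintro ⟨b, hb⟩
  obtain ⟨d, hd, h⟩ := h
  have : NeZero (q : K) := ⟨hqK⟩
  obtain ⟨ζ, hζ⟩ := HasEnoughRootsOfUnity.exists_primitiveRoot K q
  obtain ⟨d, rfl⟩ := IsAlgClosed.exists_pow_nat_eq d hq.pos
  have hval : ∀ᶠ z in infFilter v, v (f (z ^ q) ^ b / z ^ r.num) = v d := by
    filter_upwards [eventually_pow h hq.ne_zero, eventually_ne_zero] with z h₁ hz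
    have hzpow : (z ^ r.num) ^ q ≠ 0 := pow_ne_zero _ (zpow_ne_zero _ hz)
    refine val_eq_of_val_pow_eq hq.ne_zero ?_
    rw [← val_mul_eq_val_mul_iff hzpow, div_pow, mul_div_cancel₀ _ hzpow, ← pow_mul, mul_comm b,
      ← hb, h₁, ← zpow_natCast z q, ← zpow_natCast (z ^ r.num) q, ← zpow_mul, ← zpow_mul,
      mul_comm (q : ℤ)]
  have hrot (z : K) : f ((ζ * z) ^ q) ^ b / (ζ * z) ^ r.num =
      f (z ^ q) ^ b / z ^ r.num * (ζ ^ r.num)⁻¹ := by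
    rw [mul_pow, hζ.pow_eq_one, one_mul, mul_zpow, ← div_eq_mul_inv, div_div, mul_comm (ζ ^ _)]
  have hζr := eq_one_of_rotate_eq_mul (L := L) (y := fun z => f (z ^ q) ^ b / z ^ r.num)
    (by fun_prop) (pow_ne_zero_iff hq.ne_zero |>.1 hd) (hζ.ne_zero hq.ne_zero) hval hrot
  rw [inv_eq_one, hζ.zpow_eq_one_iff_dvd, Int.natCast_dvd] at hζr
  exact Nat.not_coprime_of_dvd_of_dvd hq.one_lt hζr ⟨b, hb⟩ r.reduced

theorem exists_den_eq_pow (p : ℕ) [ExpChar K p] : ∃ m, r.den = p ^ m := by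
  refine ⟨_, Nat.eq_prime_pow_of_unique_prime_dvd r.den_ne_zero fun {q} hq hqr => ?_⟩
  by_contra hqp
  refine h.not_dvd_den hf hq (fun hqK => ?_) hqr
  rcases ‹ExpChar K p› with _ | ⟨hp⟩
  · exact hq.ne_zero (by exact_mod_cast hqK)
  · exact hqp ((Nat.prime_dvd_prime_iff_eq hp hq).1 ((CharP.cast_eq_zero_iff K p q).1 hqK)).symm

theorem exists_isLeadingCoefficient : ∃ c ≠ 0, IsLeadingCoefficient v f r c := by
  obtain ⟨d, hd, h⟩ := h
  have := infFilter_neBot (v := v) (UniformlyTame.surjective L)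
  have hval : ∀ᶠ x in infFilter v, v (f x ^ r.den / x ^ r.num / d) = 0 := by
    filter_upwards [h, eventually_ne_zero] with x hx hx0
    rw [div_div, val_div_eq_zero_iff (mul_ne_zero (zpow_ne_zero _ hx0) hd), hx]
  obtain ⟨e, he⟩ := exists_eventually_val_sub_pos (L := L)
    (u := fun x => f x ^ r.den / x ^ r.num / d) (by fun_prop) (hval.mono fun x hx => hx.ge)
  have hrv : ∀ᶠ x in infFilter v, RVEq v (f x ^ r.den / x ^ r.num / d) e := by
    filter_upwards [he, hval] with x h₁ h₂ using .of_val_sub_pos h₁ h₂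
  obtain ⟨x, h₁, h₂⟩ := (hrv.and hval).exists
  have he0 := h₁.ne_zero (ne_zero_of_val_eq_zero h₂)
  obtain ⟨c, hc⟩ := IsAlgClosed.exists_pow_nat_eq (d * e) r.den_pos
  refine ⟨c, ?_, ?_⟩
  · rintro rfl
    exact mul_ne_zero hd he0 (by rw [← hc, zero_pow r.den_ne_zero])
  · filter_upwards [hrv] with x hx
    simpa only [mul_div_cancel₀ _ hd, ← hc] using hx.mul_left d

end HasSlope

end LeadingCoefficient

section Limit

variable {K : Type uK} [Field K] {Γ : Type uG} [AddCommGroup Γ] [LinearOrder Γ]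
  [IsOrderedAddMonoid Γ] {v : AddValuation K (WithTop Γ)}

theorem IsLeadingCoefficient.rv_eq [IsAlgClosed K] {p : ℕ} [ExpChar K p] {f : K → K} {r : ℚ}
    {d : K} (h : IsLeadingCoefficient v f r d) {m : ℕ} (hm : r.den = p ^ m) :
    ∀ᶠ x in infFilter v,
      rv v (f x) = fracPow p (pow_bijective_rv v p) (rv v x) r.num m * rv v d := by
  filter_upwards [h, eventually_ne_zero] with x hx hx0
  refine pow_pow_injective (pow_bijective_rv v p) m ?_
  simp only [mul_pow, fracPow_pow, ← rvHom_apply, ← map_pow, ← map_zpow₀, ← map_mul]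
  rw [rvHom_apply, rvHom_apply, rv_eq_iff, ← hm]
  simpa only [mul_div_cancel₀ _ (zpow_ne_zero r.num hx0)] using hx.mul_left (x ^ r.num)

theorem IsLeadingCoefficient.rvEq_div_fracPow [IsAlgClosed K] {p : ℕ} [ExpChar K p] {f : K → K}
    {r : ℚ} {d : K} (h : IsLeadingCoefficient v f r d) {m : ℕ} (hm : r.den = p ^ m) :
    ∀ᶠ x in infFilter v,
      RVEq v (f x / fracPow p (pow_bijective_field K p) x r.num m) d := by
  filter_upwards [h] with x hx
  refine RVEq.of_pow (p := p) (m := m) ?_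
  rwa [div_pow, fracPow_pow, ← hm]

theorem setOf_eventually_le_val_sub_eq [(infFilter v).NeBot] {G : K → K} {γ : WithTop Γ} {a : K}
    (ha : ∀ᶠ x in infFilter v, γ ≤ v (G x - a)) :
    {y | ∀ᶠ x in infFilter v, γ ≤ v (G x - y)} = {y | γ ≤ v (y - a)} := by
  ext y
  constructor
  · intro hy
    obtain ⟨x, h₁, h₂⟩ := (hy.and ha).exists
    exact le_val_sub_trans ((v.map_sub_swap _ _).symm ▸ h₁) h₂
  · intro hy
    exact ha.mono fun x hx => le_val_sub_trans hx ((v.map_sub_swap _ _).symm ▸ hy)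

theorem hasLimitAtInfinity_iff {G : K → K} {a : K} : HasLimitAtInfinity v G a ↔
    ∀ γ : Γ, ∀ᶠ x in infFilter v, (γ : WithTop Γ) < v (G x - a) :=
  forall_congr' fun _ => eventually_infFilter.symm

theorem HasLimitAtInfinity.congr {G G' : K → K} {a : K} (h : HasLimitAtInfinity v G a)
    (hG : ∀ᶠ x in infFilter v, G' x = G x) : HasLimitAtInfinity v G' a := by
  rw [hasLimitAtInfinity_iff] at h ⊢
  intro γ
  filter_upwards [h γ, hG] with x h₁ h₂
  rwa [h₂]

theorem HasLimitAtInfinity.rvEq [(infFilter v).NeBot] {G : K → K} {a d : K}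
    (h : HasLimitAtInfinity v G a) (hd : d ≠ 0) (hGd : ∀ᶠ x in infFilter v, RVEq v (G x) d) :
    RVEq v d a := by
  obtain ⟨γ, hγ⟩ := exists_val_eq_coe (v := v) hd
  obtain ⟨x, h₁, h₂⟩ := (hGd.and (hasLimitAtInfinity_iff.1 h γ)).exists
  rw [v.map_sub_swap, ← hγ, ← h₁.val_eq] at h₂
  exact (RVEq.trans (.inr h₂) h₁).symm

variable {L : FirstOrder.Language.{uF, uR}} [L.Structure K] [UniformlyTame L v]
  [DefinableField L K] [IsAlgClosed K] [Nontrivial Γ]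

theorem IsDefinablyComplete.exists_hasLimitAtInfinity (hL : IsDefinablyComplete v L) {G : K → K}
    (hG : DefinableFunction L K G) {b₀ : K} (hb₀ : ∀ᶠ x in infFilter v, v b₀ ≤ v (G x)) :
    ∃ a, HasLimitAtInfinity v G a := by
  have hv : Function.Surjective v := UniformlyTame.surjective L
  have := infFilter_neBot hv
  have hball (b : K) (hb : b ≠ 0) :
      IsBall v {y | ∀ᶠ x in infFilter v, v b ≤ v (G x - y)} (v b) := by
    obtain ⟨a, ha⟩ := exists_eventually_le_val_sub hG hb₀ hb
    exact setOf_eventually_le_val_sub_eq ha ▸ .closed a (v b)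
  have hsmall (γ : Γ) : ∃ b ≠ 0, (γ : WithTop Γ) < v b := by
    obtain ⟨δ, hδ⟩ := exists_gt γ
    obtain ⟨b, hb⟩ := hv δ
    exact ⟨b, ne_zero_of_val_eq_coe hb, by rw [hb]; exact_mod_cast hδ⟩
  obtain ⟨a, ha⟩ := hL 1 {t | t 0 ≠ 0} (fun t => {y | ∀ᶠ x in infFilter v, v (t 0) ≤ v (G x - y)})
    (show DefinablePred L K fun t : Fin 1 → K => t 0 ≠ 0 from
      .not (.eq (by fun_prop) (by fun_prop)))
    (show DefinablePred L K fun q : (Fin 1 → K) × (Fin 1 → K) =>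
      q.1 0 ≠ 0 ∧ ∀ᶠ x in infFilter v, v (q.1 0) ≤ v (G x - q.2 0) from
      .and (.not (.eq (by fun_prop) (by fun_prop)))
        (.eventually (.val_le (by fun_prop) (by fun_prop))))
    (fun t ht => ⟨_, hball _ ht⟩)
    (fun s _ t _ => (le_total (v (s 0)) (v (t 0))).symm.imp
      (fun hst y hy => hy.mono fun x => hst.trans) fun hst y hy => hy.mono fun x => hst.trans)
    (fun γ => by
      obtain ⟨b, hb, hγb⟩ := hsmall γ
      exact ⟨fun _ => b, hb, _, hball b hb, by exact_mod_cast hγb⟩)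
  refine ⟨a, hasLimitAtInfinity_iff.2 fun γ => ?_⟩
  obtain ⟨b, hb, hγb⟩ := hsmall γ
  exact (Set.mem_iInter₂.1 ha (fun _ => b) hb).mono fun x => hγb.trans_le

theorem definableFunction_fracPow (p : ℕ) [ExpChar K p] (n : ℤ) (m : ℕ) :
    DefinableFunction L K fun x : K => fracPow p (pow_bijective_field K p) x n m := by
  refine .of_graph ((DefinablePred.eq (f := fun q : K × K => q.2 ^ p ^ m)
    (g := fun q : K × K => q.1 ^ n) (by fun_prop) (by fun_prop)).congr fun q => ?_)
  rw [← (pow_pow_injective (pow_bijective_field K p) m).eq_iff, fracPow_pow]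

theorem IsLeadingCoefficient.exists_hasLimitAtInfinity {p : ℕ} [ExpChar K p] {f : K → K} {r : ℚ}
    {d : K} (h : IsLeadingCoefficient v f r d) (hL : IsDefinablyComplete v L)
    (hf : DefinableFunction L K f) (hd : d ≠ 0) {m : ℕ} (hm : r.den = p ^ m) :
    ∃ a, HasLimitAtInfinity v (fun x => f x / fracPow p (pow_bijective_field K p) x r.num m) a ∧
      RVEq v d a := by
  have := infFilter_neBot (v := v) (UniformlyTame.surjective L)
  have hrv := h.rvEq_div_fracPow hm
  obtain ⟨a, ha⟩ := hL.exists_hasLimitAtInfinity (hf.div (definableFunction_fracPow p r.num m))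
    (hrv.mono fun x hx => hx.val_eq.ge)
  exact ⟨a, ha, ha.rvEq hd hrv⟩

end Limit

/-! ### Definable families at infinity -/

section Family

theorem exists_fin_partition {α ρ : Type*} {W : Set α} {Z : Finset ρ} {s : α → ρ → Prop}
    (hs : ∀ w ∈ W, ∃ r ∈ Z, s w r) (hs' : ∀ {w r r'}, s w r → s w r' → r = r') :
    ∃ (l : ℕ) (r : Fin l → ρ), (∀ i, {w ∈ W | s w (r i)}.Nonempty) ∧
      Pairwise (fun i j => Disjoint {w ∈ W | s w (r i)} {w ∈ W | s w (r j)}) ∧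
      ⋃ i, {w ∈ W | s w (r i)} = W := by
  classical
  let e := (Z.filter fun r => ∃ w ∈ W, s w r).equivFin.symm
  refine ⟨_, fun i => e i, fun i => (Finset.mem_filter.1 (e i).2).2,
    fun i j hij => Set.disjoint_left.2 fun w hi hj =>
      hij (e.injective (Subtype.ext (hs' hi.2 hj.2))),
    Set.Subset.antisymm (Set.iUnion_subset fun i => Set.sep_subset _ _) fun w hw => ?_⟩
  obtain ⟨r, hr, hwr⟩ := hs w hw
  exact Set.mem_iUnion.2
    ⟨e.symm ⟨r, Finset.mem_filter.2 ⟨hr, w, hw, hwr⟩⟩, hw, by simpa using hwr⟩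

variable {L : FirstOrder.Language.{uF, uR}} {K : Type uK} [L.Structure K] [Field K] {k : ℕ}

theorem DefinableFamily.definableFunction_indicator {X : Set ((Fin k → K) × K)}
    {f : (Fin k → K) → K → K} (hf : DefinableFamily L X f) :
    DefinableFunction L K (X.indicator (Function.uncurry f)) := by
  have hgraph : DefinablePred L K fun q : ((Fin k → K) × K) × K =>
      q.1 ∈ X ∧ q.2 = f q.1.1 q.1.2 := by
    have hpair : DefinableFunction L K fun q : ((Fin k → K) × K) × K => ![q.1.2, q.2] :=
      .pi (Fin.forall_fin_two.2 ⟨.comp (g := Prod.snd) .snd .fst, .snd⟩)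
    exact DefinablePred.comp (P := fun q : (Fin k → K) × (Fin 2 → K) =>
      (q.1, q.2 0) ∈ X ∧ q.2 1 = f q.1 (q.2 0))
      (f := fun q : ((Fin k → K) × K) × K => (q.1.1, ![q.1.2, q.2])) hf (by fun_prop)
  have hX : DefinablePred L K fun q : (Fin k → K) × K => q ∈ X :=
    (DefinablePred.ex (P := fun (q : (Fin k → K) × K) y => q ∈ X ∧ y = f q.1 q.2) hgraph).congr
      fun q => by simp only [exists_and_left, exists_eq, and_true]
  have hX' : DefinablePred L K fun q : ((Fin k → K) × K) × K => q.1 ∈ X :=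
    hX.comp (f := fun q : ((Fin k → K) × K) × K => q.1) (by fun_prop)
  refine .of_graph ((hgraph.or (.and (.not hX')
    (.eq (f := fun q => q.2) (g := fun _ => 0) (by fun_prop) (by fun_prop)))).congr fun q => ?_)
  by_cases h : q.1 ∈ X <;> simp [h, Function.uncurry]

variable {Γ : Type uG} [AddCommGroup Γ] [LinearOrder Γ] [IsOrderedAddMonoid Γ]
  {v : AddValuation K (WithTop Γ)}

theorem EventuallyQLinearAtInfinity.exists_hasSlope (hv : Function.Surjective v) {ι : Type*}
    {W : Set ι} {X : Set (ι × K)} {f : ι → K → K} {Y : Set (ι × Γ)} {h : ι → Γ → Γ}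
    (hlin : EventuallyQLinearAtInfinity W Y h) (hfinf : ∀ w ∈ W, NearInfinity v fun x => (w, x) ∈ X)
    (hfac : ∀ w ∈ W, FactorizesAtInfinity v {x | (w, x) ∈ X} (f w) {γ | (w, γ) ∈ Y} (h w)) :
    ∃ Z : Finset ℚ, ∀ w ∈ W, ∃ r ∈ Z, HasSlope v (f w) r := by
  obtain ⟨Z, hZ⟩ := hlin
  refine ⟨Z, fun w hw => ?_⟩
  obtain ⟨r, hr, δ, α, hα⟩ := hZ w hw
  obtain ⟨γ₀, hγ₀⟩ := hfac w hw
  refine ⟨r, hr, hasSlope_of_eventually_linear hv ?_ fun γ hγ => (hα γ hγ).2⟩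
  filter_upwards [eventually_infFilter.2 (hfinf w hw), eventually_val_lt_coe γ₀] with x h₁ h₂
  obtain ⟨γ, -, hxγ, hfγ⟩ := hγ₀ x h₁ h₂
  exact ⟨γ, hxγ, hfγ⟩

variable [IsAlgClosed K]

theorem IsLeadingCoefficient.iff_rv_eq [(infFilter v).NeBot] {p : ℕ} [ExpChar K p] {f : K → K}
    {r : ℚ} {d d' : K} (h : IsLeadingCoefficient v f r d) {m : ℕ} (hm : r.den = p ^ m) :
    IsLeadingCoefficient v f r d' ↔ rv v d' = rv v d := by
  rw [rv_eq_iff]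
  constructor
  · intro h'
    obtain ⟨x, h₁, h₂⟩ := (h'.and h).exists
    exact .of_pow (p := p) (m := m) (hm ▸ h₁.symm.trans h₂)
  · exact fun hdd' => h.mono fun x hx => hx.trans (hdd'.symm.pow _)

variable [UniformlyTame L v] [DefinableField L K] [Nontrivial Γ]

theorem exists_forall_isLeadingCoefficient {ι : Type*} {F : ι → K → K}
    (hF : ∀ w, DefinableFunction L K (F w)) :
    ∃ d : ι → Kˣ, ∀ w r, HasSlope v (F w) r → IsLeadingCoefficient v (F w) r (d w) := by
  suffices ∀ w, ∃ d : Kˣ, ∀ r, HasSlope v (F w) r → IsLeadingCoefficient v (F w) r d from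
    ⟨fun w => (this w).choose, fun w => (this w).choose_spec⟩
  intro w
  by_cases hw : ∃ r, HasSlope v (F w) r
  · obtain ⟨r, hr⟩ := hw
    obtain ⟨c, hc, hrc⟩ := hr.exists_isLeadingCoefficient (hF w)
    exact ⟨.mk0 c hc, fun r' hr' => hr.unique (UniformlyTame.surjective L) hr' ▸ hrc⟩
  · exact ⟨1, fun r hr => absurd ⟨r, hr⟩ hw⟩

theorem definableRVMap_of_isLeadingCoefficient (p : ℕ) [ExpChar K p] {F : (Fin k → K) → K → K}
    (hF : DefinableFunction L K fun q : (Fin k → K) × K => F q.1 q.2) {ι : Type*} [Finite ι]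
    {P : ι → Set (Fin k → K)} (hP : ∀ i, DefinablePred L K fun w => w ∈ P i) {r : ι → ℚ}
    (hr : ∀ i, ∃ m, (r i).den = p ^ m) {d : (Fin k → K) → Kˣ}
    (hd : ∀ i, ∀ w ∈ P i, IsLeadingCoefficient v (F w) (r i) (d w)) :
    DefinableRVMap v L (⋃ i, P i) fun w => RVStar.mk v (d w) := by
  have := infFilter_neBot (v := v) (UniformlyTame.surjective L)
  change DefinablePred L K fun q : (Fin k → K) × (Fin 1 → K) =>
    ∃ c : RVStar v, rv v (q.2 0) = c ∧ q.1 ∈ ⋃ i, P i ∧ c = RVStar.mk v (d q.1)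
  have hdef : DefinablePred L K fun q : (Fin k → K) × (Fin 1 → K) =>
      ∃ i, q.1 ∈ P i ∧ IsLeadingCoefficient v (F q.1) (r i) (q.2 0) :=
    .finite_ex fun i => .and
      ((hP i).comp (f := fun q : (Fin k → K) × (Fin 1 → K) => q.1) (by fun_prop))
      (.isLeadingCoefficient (hF.comp (g := fun q : (Fin k → K) × K => F q.1 q.2)
        (f := fun q : ((Fin k → K) × (Fin 1 → K)) × K => (q.1.1, q.2)) (by fun_prop)) _
        (by fun_prop))
  refine hdef.congr fun q => ?_
  have hiff (i) (hi : q.1 ∈ P i) :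
      IsLeadingCoefficient v (F q.1) (r i) (q.2 0) ↔ rv v (q.2 0) = RVStar.mk v (d q.1) := by
    obtain ⟨m, hm⟩ := hr i
    rw [(hd i _ hi).iff_rv_eq hm, rv_coe]
  rw [Set.mem_iUnion]
  constructor
  · rintro ⟨c, h, ⟨i, hi⟩, rfl⟩
    exact ⟨i, hi, (hiff i hi).2 h⟩
  · rintro ⟨i, hi, h⟩
    exact ⟨_, (hiff i hi).1 h, ⟨i, hi⟩, rfl⟩

theorem exists_definable_partition_isLeadingCoefficient (p : ℕ) [ExpChar K p]
    {F : (Fin k → K) → K → K}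
    (hF : DefinableFunction L K fun q : (Fin k → K) × K => F q.1 q.2) {W : Set (Fin k → K)}
    (hW : DefinableK L W) {Z : Finset ℚ} (hZ : ∀ w ∈ W, ∃ r ∈ Z, HasSlope v (F w) r) :
    ∃ (l : ℕ) (P : Fin l → Set (Fin k → K)) (r : Fin l → ℚ) (d : (Fin k → K) → Kˣ),
      (∀ i, DefinableK L (P i)) ∧ (∀ i, (P i).Nonempty) ∧
      Pairwise (fun i j => Disjoint (P i) (P j)) ∧ (⋃ i, P i) = W ∧
      (∀ i, ∃ m, (r i).den = p ^ m) ∧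
      ∀ i, ∀ w ∈ P i, IsLeadingCoefficient v (F w) (r i) (d w) := by
  have hFw (w) : DefinableFunction L K (F w) := hF.comp (f := fun x => (w, x)) (by fun_prop)
  have hP (r : ℚ) : DefinablePred L K fun w => w ∈ W ∧ HasSlope v (F w) r :=
    .and hW (.hasSlope hF r)
  obtain ⟨l, r, hne, hdisj, hunion⟩ :=
    exists_fin_partition hZ (HasSlope.unique (UniformlyTame.surjective L))
  obtain ⟨d, hd⟩ := exists_forall_isLeadingCoefficient (v := v) hFw
  exact ⟨l, _, r, d, fun i => hP (r i), hne, hdisj, hunion,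
    fun i => (hne i).elim fun w hw => hw.2.exists_den_eq_pow (hFw w) p,
    fun i w hw => hd w _ hw.2⟩

end Family

theorem mainTheorem6_general
    {K : Type uK} [Field K] [IsAlgClosed K]
    {Γ : Type uG} [AddCommGroup Γ] [LinearOrder Γ] [IsOrderedAddMonoid Γ] [Nontrivial Γ]
    (v : AddValuation K (WithTop Γ)) (hv : Function.Surjective v) (p : ℕ) [ExpChar K p]
    {L : FirstOrder.Language.{uF, uR}} [L.Structure K] (φ : FirstOrder.Language.LHom Ldiv L)
    (hφ : IsValuedFieldExpansion v φ) (hC : IsCMinimal φ K)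
    {k : ℕ} (W : Set (Fin k → K)) (hW : DefinableK L W)
    (X : Set ((Fin k → K) × K)) (f : (Fin k → K) → K → K) (hf : DefinableFamily L X f)
    (hfinf : ∀ w ∈ W, NearInfinity v (fun x => (w, x) ∈ X))
    (Y : Set ((Fin k → K) × Γ)) (h : (Fin k → K) → Γ → Γ)
    (hfac : ∀ w ∈ W, FactorizesAtInfinity v {x | (w, x) ∈ X} (f w) {γ | (w, γ) ∈ Y} (h w))
    (hlin : EventuallyQLinearAtInfinity W Y h) :
    ∃ (l : ℕ) (P : Fin l → Set (Fin k → K)) (n m : Fin l → ℤ) (c : (Fin k → K) → RVStar v),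
      (∀ i, DefinableK L (P i)) ∧ (∀ i, (P i).Nonempty) ∧
      Pairwise (fun i j => Disjoint (P i) (P j)) ∧ (⋃ i, P i) = W ∧
      DefinableRVMap v L W c ∧
      (∀ i, ∀ w ∈ P i, NearInfinity v (fun x =>
        rv v (f w x) = fracPow p (pow_bijective_rv v p) (rv v x) (n i) (m i) * (c w : RV v))) ∧
      (IsDefinablyComplete v L → ∀ i, ∀ w ∈ P i, ∃ a : K,
        HasLimitAtInfinity v
          (fun x => f w x / fracPow p (pow_bijective_field K p) x (n i) (m i)) a ∧
        (c w : RV v) = rv v a) := by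
  have := hφ.definableField
  have := hφ.uniformlyTame hv hC
  set F : (Fin k → K) → K → K := fun w x => X.indicator (Function.uncurry f) (w, x)
  have hF : DefinableFunction L K fun q : (Fin k → K) × K => F q.1 q.2 :=
    hf.definableFunction_indicator
  have hFw (w) : DefinableFunction L K (F w) := hF.comp (f := fun x => (w, x)) (by fun_prop)
  have hFf (w) (hw : w ∈ W) : ∀ᶠ x in infFilter v, F w x = f w x :=
    (eventually_infFilter.2 (hfinf w hw)).mono fun x hx => Set.indicator_of_mem hx _
  obtain ⟨Z, hZ⟩ := hlin.exists_hasSlope hv hfinf hfac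
  have hFZ (w) (hw : w ∈ W) : ∃ r ∈ Z, HasSlope v (F w) r :=
    (hZ w hw).imp fun _ ⟨hr, hfr⟩ => ⟨hr, hfr.congr (hFf w hw)⟩
  obtain ⟨l, P, r, d, hP, hne, hdisj, rfl, hden, hd⟩ :=
    exists_definable_partition_isLeadingCoefficient p hF hW hFZ
  choose m hm using hden
  have hFP (i) (w) (hw : w ∈ P i) := hFf w (Set.mem_iUnion_of_mem i hw)
  refine ⟨l, P, fun i => (r i).num, fun i => m i, fun w => RVStar.mk v (d w), hP, hne, hdisj, rfl,
    definableRVMap_of_isLeadingCoefficient p hF hP (fun i => ⟨m i, hm i⟩) hd,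
    fun i w hw => eventually_infFilter.1 ?_, fun hL i w hw => ?_⟩
  · filter_upwards [(hd i w hw).rv_eq (hm i), hFP i w hw] with x h₁ h₂
    rw [← h₂, h₁, rv_coe]
  · obtain ⟨a, ha, hda⟩ :=
      (hd i w hw).exists_hasLimitAtInfinity hL (hFw w) (d w).ne_zero (hm i)
    exact ⟨a, ha.congr ((hFP i w hw).mono fun x hx => by rw [hx]), by rwa [← rv_coe, rv_eq_iff]⟩

theorem mainTheorem6
    -- a non-trivially valued algebraically closed field with value group `Γ`
    {K : Type uK} [Field K] [IsAlgClosed K]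
    {Γ : Type uG} [AddCommGroup Γ] [LinearOrder Γ] [IsOrderedAddMonoid Γ] [Nontrivial Γ]
    (v : AddValuation K (WithTop Γ)) (hv : Function.Surjective v)
    -- its characteristic exponent
    (p : ℕ) [ExpChar K p]
    -- a `C`-minimal expansion
    {L : FirstOrder.Language.{uF, uR}} [L.Structure K] (φ : FirstOrder.Language.LHom Ldiv L)
    (hφ : IsValuedFieldExpansion v φ) (hC : IsCMinimal φ K)
    -- a definable family of functions `f : X ⊆ W × K → Kˣ` defined at a neighborhood of infinity
    {k : ℕ} (W : Set (Fin k → K)) (hW : DefinableK L W)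
    (X : Set ((Fin k → K) × K)) (hXW : ∀ z ∈ X, z.1 ∈ W)
    (f : (Fin k → K) → K → K) (hf : DefinableFamily L X f)
    (hf0 : ∀ w x, (w, x) ∈ X → f w x ≠ 0)
    (hfinf : ∀ w ∈ W, NearInfinity v (fun x => (w, x) ∈ X))
    -- an eventually `ℚ`-linear `Γ`-factorization `h : Y ⊆ W × Γ → Γ` of `f` at infinity
    (Y : Set ((Fin k → K) × Γ)) (hYW : ∀ z ∈ Y, z.1 ∈ W)
    (h : (Fin k → K) → Γ → Γ) (hh : DefinableΓFamily v L Y h)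
    (hfac : ∀ w ∈ W, FactorizesAtInfinity v {x | (w, x) ∈ X} (f w) {γ | (w, γ) ∈ Y} (h w))
    (hlin : EventuallyQLinearAtInfinity W Y h) :
    ∃ (l : ℕ) (P : Fin l → Set (Fin k → K)) (n m : Fin l → ℤ) (c : (Fin k → K) → RVStar v),
      -- `P` is a finite definable partition of `W`
      (∀ i, DefinableK L (P i)) ∧ (∀ i, (P i).Nonempty) ∧
      Pairwise (fun i j => Disjoint (P i) (P j)) ∧ (⋃ i, P i) = W ∧
      DefinableRVMap v L W c ∧
      (∀ i, ∀ w ∈ P i, NearInfinity v (fun x =>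
        rv v (f w x) = fracPow p (pow_bijective_rv v p) (rv v x) (n i) (m i) * (c w : RV v))) ∧
      (IsDefinablyComplete v L → (∀ g : Γ → Γ, DefinableΓFun v L g → EventuallyLinear g) →
        ∀ i, ∀ w ∈ P i, ∃ a : K,
          HasLimitAtInfinity v
            (fun x => f w x / fracPow p (pow_bijective_field K p) x (n i) (m i)) a ∧
          (c w : RV v) = rv v a) := by
  obtain ⟨l, P, n, m, c, hP, hne, hdisj, hunion, hc, hrv, hlim⟩ :=
    mainTheorem6_general v hv p φ hφ hC W hW X f hf hfinf Y h hfac hlin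
  exact ⟨l, P, n, m, c, hP, hne, hdisj, hunion, hc, hrv, fun hL _ => hlim hL⟩
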